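/- \textbf{Conventions.} A \emph{metric graph} $\Gamma$ is a connected finite topological graph (not a single point) with a finite set $V_\infty(\Gamma)$ of $1$-valent points (the points at infinity) and a complete path metric on $\Gamma\setminus V_\infty(\Gamma)$. A \emph{vertex set} is a finite subset $V$ of $\Gamma$ containing all points of valence $\neq 2$, chosen such that each edge (connected component of $\Gamma\setminus V$) has two different end vertices; an edge has a length in $(0,\infty]$, which is $\infty$ exactly if an end of it lies in $V_\infty(\Gamma)$. The \emph{genus} is $g(\Gamma)=|E|-|V|+1$, where $E$ is the set of edges. An \emph{elementary tropical modification} of $\Gamma$ is obtained by attaching an infinite closed edge $[0,\infty]$ at a point of $\Gamma\setminus V_\infty(\Gamma)$; a \emph{tropical modification} is a composition of finitely many (possibly zero) of these. A continuous map $\phi:\Gamma'\to\Gamma$ is a \emph{finite morphism} if, for suitable vertex sets $V'$ and $V$, it maps $V'$ into $V$, the inverse image of each closed edge of $(\Gamma,V)$ is a union of closed edges of $(\Gamma',V')$, and $\phi$ maps each edge $e'$ of $(\Gamma',V')$ onto an edge of $(\Gamma,V)$ as a dilation of some factor $d_{e'}(\phi)\in\mathbb Z_{>0}$. Such a $\phi$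 induces a map from the tangent directions at $P'\in\Gamma'$ to those at $\phi(P')$. It is \emph{harmonic} if it is surjective and, for each $P'\in\Gamma'$, the sum $d_{P'}(\phi)$ of the numbers $d_{e'}(\phi)$, over the tangent directions at $P'$ (each defined by an edge $e'$) that are mapped to a given tangent direction $v$ at $\phi(P')$, does not depend on $v$. Its \emph{degree} is $\sum_{\phi(P')=P}d_{P'}(\phi)$, which does not depend on $P\in\Gamma$. Let $G_0$ be the metric graph of genus $2$ that consists of two points $v_1,v_2$ joined by three edges $e_0,e_1,e_2$ of finite, pairwise different lengths, and let $m_i$ be the midpoint of $e_i$. Let $n\ge 2$, let $q_0=m_0$, let $q_1$ be a point of $e_1$ strictly between $v_1$ and $m_1$, let $q_2$ be a point of $e_2$ strictly between $v_2$ and $m_2$, and let $q_3,\dots,q_n$ be further points of $G_0$ such that $q_0,\dots,q_n$ are pairwise different. Let $G_n$ be the metric graph obtained from $G_0$ by attaching, for each $0\le i\le n$, a loop $\gamma_i$ of arbitrary finite positive length at $q_i$. \textbf{Theorem.} There is no tropical modification $G_n'$ of $G_n$ for which there exist a metric graph $E$ of genus $1$ and a finite harmonic morphism $\phi:G_n'\to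 E$ of degree $2$. -/

import Mathlib

open scoped NNReal ENNReal

noncomputable section

/-- A (connected) metric graph together with a vertex set. Edges have two different end vertices,
and lengths in `(0, ∞]`. Each edge `e` is a copy of the interval `[0, len e]`, with `0` at `src e`
and `len e` at `tgt e`. The end `tgt e` of an edge of infinite length is a point at infinity; such
a point is 1-valent. (Vertex sets are taken such that no edge has both of its ends at infinity.)
The underlying space is `WeightedGraph.Point` below; other vertex sets on the same metric graph are
obtained through isomorphisms of metric graphs (`MetricIso`). -/
structure WeightedGraph where
  V : Type
  E : Type
  finV : Finite V
  finE : Finite E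
  neE : Nonempty E
  src : E → V
  tgt : E → V
  len : E → ℝ≥0∞
  len_pos : ∀ e, 0 < len e
  src_ne_tgt : ∀ e, src e ≠ tgt e
  univalent : ∀ e, len e = ∞ → ∀ f, src f = tgt e ∨ tgt f = tgt e → f = e
  connected : ∀ v w, Relation.EqvGen (fun a b => ∃ e, src e = a ∧ tgt e = b) v w

namespace WeightedGraph

/-- The genus `|E| - |V| + 1`. -/
def genus (Γ : WeightedGraph) : ℤ := (Nat.card Γ.E : ℤ) - Nat.card Γ.V + 1

/-- The vertices at infinity, that is, the vertices in `V_∞`. -/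
def IsInfinite (Γ : WeightedGraph) (v : Γ.V) : Prop := ∃ e, Γ.len e = ∞ ∧ Γ.tgt e = v

/-- The points of the metric graph: the vertices, and the points in the interior of the edges. -/
inductive Point (Γ : WeightedGraph) : Type
  | vertex (v : Γ.V) : Point Γ
  | inner (e : Γ.E) (t : ℝ≥0∞) (h0 : 0 < t) (h1 : t < Γ.len e) : Point Γ

open Classical in
/-- The parametrization `[0, len e] → Γ` of the closed edge `e` by arc length
(values of the parameter above `len e` are not used). -/
def pt (Γ : WeightedGraph) (e : Γ.E) (t : ℝ≥0∞) : Γ.Point :=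
  if h0 : 0 < t then
    if h1 : t < Γ.len e then Point.inner e t h0 h1 else Point.vertex (Γ.tgt e)
  else Point.vertex (Γ.src e)

/-- The closure of the edge `e`. -/
def closedEdge (Γ : WeightedGraph) (e : Γ.E) : Set Γ.Point := Γ.pt e '' Set.Iic (Γ.len e)

/-- The topology: the quotient topology obtained by gluing the intervals `[0, len e]`. -/
instance (Γ : WeightedGraph) : TopologicalSpace Γ.Point :=
  ⨆ e, TopologicalSpace.coinduced (fun t : Set.Iic (Γ.len e) => Γ.pt e t) inferInstance

/-- The length of the shortest segment from `x` to `y` inside one closed edge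
(`∞` if there is none). -/
def segDist (Γ : WeightedGraph) (x y : Γ.Point) : ℝ≥0∞ :=
  ⨅ (e : Γ.E) (s : ℝ≥0∞) (t : ℝ≥0∞) (_ : s ≤ Γ.len e) (_ : t ≤ Γ.len e)
    (_ : Γ.pt e s = x) (_ : Γ.pt e t = y), (s - t) + (t - s)

/-- The length of the polygonal path from `x` to `y` through the points of a list. -/
def chainLength (Γ : WeightedGraph) : Γ.Point → List Γ.Point → Γ.Point → ℝ≥0∞
  | x, [], y => Γ.segDist x y
  | x, z :: l, y => Γ.segDist x z + chainLength Γ z l y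

/-- The path metric of the metric graph. The distance from a point at infinity to any other point
is `∞`. -/
def pathDist (Γ : WeightedGraph) (x y : Γ.Point) : ℝ≥0∞ := ⨅ l : List Γ.Point, Γ.chainLength x l y

/-- An isomorphism of metric graphs: an isometric homeomorphism. -/
structure MetricIso (Γ Δ : WeightedGraph) where
  toHomeo : Γ.Point ≃ₜ Δ.Point
  pathDist_eq : ∀ x y, Δ.pathDist (toHomeo x) (toHomeo y) = Γ.pathDist x y

/-- The tangent space at `P`: the directions in which one can leave `P`. The pair `(e, true)` is
the direction along `e` with increasing parameter, `(e, false)` the one with decreasing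
parameter. -/
def tangent (Γ : WeightedGraph) (P : Γ.Point) : Set (Γ.E × Bool) :=
  {v | ∃ t ≤ Γ.len v.1, Γ.pt v.1 t = P ∧ ((v.2 = true ∧ t < Γ.len v.1) ∨ (v.2 = false ∧ 0 < t))}

/-- The map `φ` sends the edge `e'` onto the edge `e` as a dilation of factor `k > 0`;
`rev` says whether it reverses the directions of the parametrizations. -/
def IsDilation {Γ' Γ : WeightedGraph} (φ : Γ'.Point → Γ.Point) (e' : Γ'.E) (e : Γ.E)
    (k : ℕ) (rev : Bool) : Prop :=
  0 < k ∧ (k : ℝ≥0∞) * Γ'.len e' = Γ.len e ∧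
    ((rev = false ∧ ∀ t ≤ Γ'.len e', φ (Γ'.pt e' t) = Γ.pt e (k * t)) ∨
      (rev = true ∧ Γ.len e ≠ ∞ ∧ ∀ t ≤ Γ'.len e', φ (Γ'.pt e' t) = Γ.pt e (Γ.len e - k * t)))

/-- The map `φ` is a morphism of metric graphs with vertex sets,
with degree `d e'` along each edge `e'`. -/
structure IsModelMorphism {Γ' Γ : WeightedGraph} (φ : Γ'.Point → Γ.Point) (d : Γ'.E → ℕ) :
    Prop where
  continuous : Continuous φ
  vertex : ∀ v', ∃ v, φ (Point.vertex v') = Point.vertex v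
  preimage : ∀ e, ∃ S : Set Γ'.E, φ ⁻¹' Γ.closedEdge e = ⋃ e' ∈ S, Γ'.closedEdge e'
  edge : ∀ e', (d e' = 0 ∧ ∃ v, ∀ P ∈ Γ'.closedEdge e', φ P = Point.vertex v) ∨
    ∃ e rev, IsDilation φ e' e (d e') rev

/-- The tangent direction `v'` is mapped to the tangent direction `v` by the map `φ`
(of degree `d e'` along the edges `e'`). -/
def MapsTangent {Γ' Γ : WeightedGraph} (φ : Γ'.Point → Γ.Point) (d : Γ'.E → ℕ)
    (v' : Γ'.E × Bool) (v : Γ.E × Bool) : Prop :=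
  ∃ rev, IsDilation φ v'.1 v.1 (d v'.1) rev ∧ v.2 = xor v'.2 rev

/-- The morphism `φ` is harmonic at `P'`, of degree `m`. -/
def IsHarmonicAt {Γ' Γ : WeightedGraph} (φ : Γ'.Point → Γ.Point) (d : Γ'.E → ℕ)
    (P' : Γ'.Point) (m : ℕ) : Prop :=
  ∀ v ∈ Γ.tangent (φ P'), ∑ᶠ v' ∈ {v' | v' ∈ Γ'.tangent P' ∧ MapsTangent φ d v' v}, d v'.1 = m

/-- The map `φ` is a finite harmonic morphism of degree `D` of metric graphs with vertex sets. -/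
def IsModelFiniteHarmonic {Γ' Γ : WeightedGraph} (φ : Γ'.Point → Γ.Point) (D : ℕ) : Prop :=
  ∃ (d : Γ'.E → ℕ) (m : Γ'.Point → ℕ), IsModelMorphism φ d ∧ (∀ e', 0 < d e') ∧
    Function.Surjective φ ∧ (∀ P', IsHarmonicAt φ d P' (m P')) ∧
    ∀ P, ∑ᶠ P' ∈ φ ⁻¹' {P}, m P' = D

/-- The map `φ` is a finite harmonic morphism of degree `D` of metric graphs: it is one for
suitable vertex sets (those of the graphs `H'` and `H`, which are isometric to `Γ'` and `Γ`). -/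
def IsFiniteHarmonicMorphism {Γ' Γ : WeightedGraph} (φ : Γ'.Point → Γ.Point) (D : ℕ) : Prop :=
  ∃ (H' H : WeightedGraph) (h' : MetricIso H' Γ') (h : MetricIso H Γ),
    IsModelFiniteHarmonic (fun P => h.toHomeo.symm (φ (h'.toHomeo P))) D

theorem eqvGen_map {α β : Type} {r : α → α → Prop} {s : β → β → Prop} (f : α → β)
    (hf : ∀ a b, r a b → s (f a) (f b)) {a b : α} (h : Relation.EqvGen r a b) :
    Relation.EqvGen s (f a) (f b) := by
  induction h with
  | rel _ _ h => exact .rel _ _ (hf _ _ h)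
  | refl _ => exact .refl _
  | symm _ _ _ ih => exact .symm _ _ ih
  | trans _ _ _ _ _ ih1 ih2 => exact .trans _ _ _ ih1 ih2

/-- The graph obtained by attaching an infinite closed edge at the vertex `p`. -/
def attachRay (Γ : WeightedGraph) (p : Γ.V) (hp : ¬ Γ.IsInfinite p) : WeightedGraph where
  V := Option Γ.V
  E := Option Γ.E
  finV := by have := Γ.finV; infer_instance
  finE := by have := Γ.finE; infer_instance
  neE := ⟨none⟩
  src e := some (e.elim p Γ.src)
  tgt e := e.map Γ.tgt
  len e := e.elim ∞ Γ.len
  len_pos := by rintro (_ | e) <;> simp [Γ.len_pos]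
  src_ne_tgt := by rintro (_ | e) <;> simp [Γ.src_ne_tgt]
  univalent := by
    rintro (_ | e) he (_ | f) hf
    · rfl
    · simp at hf
    · simp only [Option.elim, Option.map, Option.some.injEq, reduceCtorEq, or_false] at he hf
      exact (hp ⟨e, he, hf.symm⟩).elim
    · simp only [Option.elim, Option.map, Option.some.injEq] at he hf
      exact congrArg some (Γ.univalent e he f hf)
  connected := by
    have key : ∀ v : Option Γ.V, Relation.EqvGen (fun a b => ∃ e : Option Γ.E,
        some (e.elim p Γ.src) = a ∧ e.map Γ.tgt = b) (some p) v := by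
      rintro (_ | v)
      · exact .rel _ _ ⟨none, rfl, rfl⟩
      · refine eqvGen_map some ?_ (Γ.connected p v)
        rintro a b ⟨e, rfl, rfl⟩
        exact ⟨some e, rfl, rfl⟩
    exact fun v w => .trans _ _ _ (.symm _ _ (key v)) (key w)

/-- The graph obtained by attaching, for each `i`, a loop of length `c i` at the vertex `p i`. The
loop consists of two edges of length `c i / 2` from `p i` to a new vertex. -/
def attachLoops (Γ : WeightedGraph) {k : ℕ} (p : Fin k → Γ.V) (hp : ∀ i, ¬ Γ.IsInfinite (p i))
    (c : Fin k → ℝ≥0) (hc : ∀ i, 0 < c i) : WeightedGraph where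
  V := Γ.V ⊕ Fin k
  E := Γ.E ⊕ (Fin k × Bool)
  finV := by have := Γ.finV; infer_instance
  finE := by have := Γ.finE; infer_instance
  neE := by have := Γ.neE; infer_instance
  src := Sum.elim (fun e => Sum.inl (Γ.src e)) (fun i => Sum.inl (p i.1))
  tgt := Sum.elim (fun e => Sum.inl (Γ.tgt e)) (fun i => Sum.inr i.1)
  len := Sum.elim Γ.len (fun i => ((c i.1 / 2 : ℝ≥0) : ℝ≥0∞))
  len_pos := by
    rintro (e | i)
    · exact Γ.len_pos e
    · exact ENNReal.coe_pos.2 (half_pos (hc i.1))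
  src_ne_tgt := by rintro (e | i) <;> simp [Γ.src_ne_tgt]
  univalent := by
    rintro (e | i) he (f | j) hf
    · simp only [Sum.elim_inl, Sum.inl.injEq] at he hf
      exact congrArg Sum.inl (Γ.univalent e he f hf)
    · simp only [Sum.elim_inl, Sum.elim_inr, Sum.inl.injEq, reduceCtorEq, or_false] at he hf
      exact (hp j.1 ⟨e, he, hf.symm⟩).elim
    · exact (ENNReal.coe_ne_top he).elim
    · exact (ENNReal.coe_ne_top he).elim
  connected := by
    have key : ∀ a b : Γ.V, Relation.EqvGen (fun a b => ∃ e : Γ.E ⊕ (Fin k × Bool),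
        Sum.elim (fun e => Sum.inl (Γ.src e)) (fun i => Sum.inl (p i.1)) e = a ∧
        Sum.elim (fun e => Sum.inl (Γ.tgt e)) (fun i => Sum.inr i.1) e = b)
        (Sum.inl a : Γ.V ⊕ Fin k) (Sum.inl b) := by
      intro a b
      refine eqvGen_map Sum.inl ?_ (Γ.connected a b)
      rintro a b ⟨e, rfl, rfl⟩
      exact ⟨Sum.inl e, rfl, rfl⟩
    obtain ⟨e⟩ := Γ.neE
    have key2 : ∀ v : Γ.V ⊕ Fin k, Relation.EqvGen (fun a b => ∃ e : Γ.E ⊕ (Fin k × Bool),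
        Sum.elim (fun e => Sum.inl (Γ.src e)) (fun i => Sum.inl (p i.1)) e = a ∧
        Sum.elim (fun e => Sum.inl (Γ.tgt e)) (fun i => Sum.inr i.1) e = b)
        (Sum.inl (Γ.src e)) v := by
      rintro (v | i)
      · exact key _ v
      · exact .trans _ _ _ (key _ (p i)) (.rel _ _ ⟨Sum.inr (i, true), rfl, rfl⟩)
    exact fun v w => .trans _ _ _ (.symm _ _ (key2 v)) (key2 w)

/-- `Γ'` is obtained from the metric graph `Γ` by attaching an infinite closed edge at a point that
is not at infinity. (`H` is `Γ` with a vertex set that contains the point.) -/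
def IsElementaryTropicalModification (Γ Γ' : WeightedGraph) : Prop :=
  ∃ (H : WeightedGraph) (_ : MetricIso H Γ) (p : H.V) (hp : ¬ H.IsInfinite p),
    Nonempty (MetricIso Γ' (H.attachRay p hp))

/-- `Γ'` is a tropical modification of `Γ`: a composition of finitely many elementary ones. -/
def IsTropicalModification (Γ Γ' : WeightedGraph) : Prop :=
  Relation.ReflTransGen IsElementaryTropicalModification Γ Γ'

/-- `G` is obtained from the metric graph `Γ` by attaching, for each `i`, a loop of length `c i` at
the point `q i`. (`H` is `Γ` with a vertex set that contains the points `q i`.) -/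
def IsObtainedByAttachingLoops (Γ : WeightedGraph) {k : ℕ} (q : Fin k → Γ.Point)
    (c : Fin k → ℝ≥0) (G : WeightedGraph) : Prop :=
  ∃ (H : WeightedGraph) (h : MetricIso H Γ) (p : Fin k → H.V) (hp : ∀ i, ¬ H.IsInfinite (p i))
    (hc : ∀ i, 0 < c i),
    (∀ i, h.toHomeo (Point.vertex (p i)) = q i) ∧ Nonempty (MetricIso G (H.attachLoops p hp c hc))

/-- The theta graph: two vertices `v_1` (`false`) and `v_2` (`true`) joined by three edges
`e_0`, `e_1`, `e_2` of lengths `L 0`, `L 1`, `L 2`. -/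
def theta (L : Fin 3 → ℝ≥0) (hL : ∀ i, 0 < L i) : WeightedGraph where
  V := Bool
  E := Fin 3
  finV := inferInstance
  finE := inferInstance
  neE := inferInstance
  src _ := false
  tgt _ := true
  len i := L i
  len_pos i := ENNReal.coe_pos.2 (hL i)
  src_ne_tgt _ := Bool.false_ne_true
  univalent e he := (ENNReal.coe_ne_top he).elim
  connected := by
    have h : Relation.EqvGen (fun a b : Bool => ∃ _ : Fin 3, false = a ∧ true = b) false true :=
      .rel _ _ ⟨0, rfl, rfl⟩
    rintro (_ | _) (_ | _)
    · exact .refl _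
    · exact h
    · exact .symm _ _ h
    · exact .refl _

/-- The point on the edge `e_i` of the theta graph at distance `t ≤ L i` from `v_1` along `e_i`. -/
def thetaPoint (L : Fin 3 → ℝ≥0) (hL : ∀ i, 0 < L i) (i : Fin 3) (t : ℝ≥0) : (theta L hL).Point :=
  (theta L hL).pt i t

end WeightedGraph

end

/-!
A harmonic morphism `φ` of degree two is the quotient by an involution: over each point there are
two points of local degree one or one point of local degree two, and interchanging the two points
of each fiber is an isometry `ι` (`IsFiniteHarmonicMorphism.exists_involution`).

Homology is replaced by counting components after removing finitely many points. A connected graph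
with vertices `V` has at least `|V| - 1` edges, so removing any two points that are not vertices
disconnects a graph of genus one (`not_isPreconnected_compl_pair_of_genus_eq_one`). It is therefore
enough to find two points `x`, `y` of the modified graph such that removing their orbits
`x, ι x, y, ι y` does not disconnect: the image of what is left is the complement of two points.

The graph `G_n` consists of the three arcs of the theta graph and of the loops, and a tropical
modification attaches trees to it. Almost all points of the trees are cut points, so `ι` maps
`G_n` to itself; two generic points of `G_n` disconnect together exactly if they lie on the same
arc or loop, and the arcs are the only parts three of which disconnect together but not in pairs.
Hence `ι` permutes the arcs and permutes the loops (`IsLoopedTheta.exists_map_parts`). Being an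
isometry, it preserves each of the three arcs, as their lengths differ, and it is either the
identity on the theta graph or the reflection of all arcs at their midpoints (`theta_involution`).
In the first case, `x` and `y` are taken on two of the arcs. In the second case, the loops at `q 1`
and `q 2` are mapped to loops at points of the same arcs other than `q 1` and `q 2`, since these
are not midpoints; so the loops at `q 1` and `q 2` and their images are four different loops, and
`x` and `y` are taken on the loops at `q 1` and `q 2` (`false_of_independent_parts`).

The subgraphs are handled by retractions that collapse the attached pieces (`Retraction`). Since
only finitely many points are attaching points, connectedness after the removal of generic points
can be decided in the subgraph (`Retraction.isPreconnected_compl_image_iff`).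
-/

noncomputable section
namespace WeightedGraph

open Set Topology

variable {Γ' Γ Δ Θ : WeightedGraph}

/-! ### Points and topology of a graph -/

theorem pt_zero (e : Γ.E) : Γ.pt e 0 = Point.vertex (Γ.src e) := by
  simp [pt]

theorem pt_len (e : Γ.E) : Γ.pt e (Γ.len e) = Point.vertex (Γ.tgt e) := by
  simp [pt, Γ.len_pos e]

theorem pt_of_lt (e : Γ.E) {t : ℝ≥0∞} (h0 : 0 < t) (h1 : t < Γ.len e) :
    Γ.pt e t = Point.inner e t h0 h1 := by
  simp [pt, h0, h1]

/-- A parameter on a closed edge is an end or an inner parameter. -/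
theorem eq_or_eq_or_lt (e : Γ.E) {t : ℝ≥0∞} (ht : t ≤ Γ.len e) :
    t = 0 ∨ t = Γ.len e ∨ (0 < t ∧ t < Γ.len e) := by
  rcases eq_or_ne t 0 with h | h
  · exact Or.inl h
  · rcases ht.eq_or_lt with h' | h'
    · exact Or.inr (Or.inl h')
    · exact Or.inr (Or.inr ⟨pos_iff_ne_zero.2 h, h'⟩)

theorem pt_injOn (e : Γ.E) : InjOn (Γ.pt e) (Iic (Γ.len e)) := by
  intro s hs t ht h
  have hne := Γ.src_ne_tgt e
  rcases eq_or_eq_or_lt e hs with rfl | rfl | ⟨h1, h2⟩ <;>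
    rcases eq_or_eq_or_lt e ht with rfl | rfl | ⟨h3, h4⟩ <;>
    simp_all [pt_zero, pt_len, pt_of_lt]

theorem pt_inj (e : Γ.E) {s t : ℝ≥0∞} (hs : s ≤ Γ.len e) (ht : t ≤ Γ.len e)
    (h : Γ.pt e s = Γ.pt e t) : s = t :=
  pt_injOn e hs ht h

theorem edge_eq_of_pt_eq {e f : Γ.E} {s t : ℝ≥0∞} (h0 : 0 < s) (h1 : s < Γ.len e)
    (h : Γ.pt e s = Γ.pt f t) : f = e ∧ t = s := by
  rw [pt_of_lt e h0 h1] at h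
  unfold pt at h
  split_ifs at h
  simp_all

theorem exists_edge (v : Γ.V) : ∃ e, Γ.src e = v ∨ Γ.tgt e = v := by
  by_contra! hv
  obtain ⟨e⟩ := Γ.neE
  have key : ∀ a b, Relation.EqvGen (fun a b => ∃ e, Γ.src e = a ∧ Γ.tgt e = b) a b →
      (a = v ↔ b = v) := by
    intro a b h
    induction h with
    | rel a b h =>
      obtain ⟨e, rfl, rfl⟩ := h
      simp [hv e]
    | refl => rfl
    | symm _ _ _ ih => exact ih.symm
    | trans _ _ _ _ _ ih1 ih2 => exact ih1.trans ih2
  exact (hv e).1 ((key _ _ (Γ.connected v (Γ.src e))).1 rfl)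

theorem exists_pt_eq (P : Γ.Point) : ∃ e, ∃ t ≤ Γ.len e, Γ.pt e t = P := by
  rcases P with v | ⟨e, t, h0, h1⟩
  · obtain ⟨e, rfl | rfl⟩ := exists_edge v
    · exact ⟨e, 0, zero_le, pt_zero e⟩
    · exact ⟨e, _, le_rfl, pt_len e⟩
  · exact ⟨e, t, h1.le, pt_of_lt e h0 h1⟩

theorem isOpen_iff {U : Set Γ.Point} :
    IsOpen U ↔ ∀ e, IsOpen ((fun t : Iic (Γ.len e) => Γ.pt e t) ⁻¹' U) := by
  rw [isOpen_iSup_iff]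
  rfl

theorem isClosed_iff {U : Set Γ.Point} :
    IsClosed U ↔ ∀ e, IsClosed ((fun t : Iic (Γ.len e) => Γ.pt e t) ⁻¹' U) := by
  simp only [← isOpen_compl_iff, isOpen_iff, preimage_compl]

theorem continuous_iff {X : Type*} [TopologicalSpace X] {f : Γ.Point → X} :
    Continuous f ↔ ∀ e, Continuous (fun t : Iic (Γ.len e) => f (Γ.pt e t)) := by
  simp only [continuous_def, isOpen_iff]
  exact ⟨fun h e s hs => h s hs e, fun h s hs e => h e s hs⟩

theorem continuous_pt (e : Γ.E) : Continuous (fun t : Iic (Γ.len e) => Γ.pt e t) :=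
  continuous_iff.1 continuous_id e

theorem continuousOn_pt (e : Γ.E) : ContinuousOn (Γ.pt e) (Iic (Γ.len e)) :=
  continuousOn_iff_continuous_domRestrict.2 (continuous_pt e)

theorem isPreconnected_pt_image (e : Γ.E) {s : Set ℝ≥0∞} (hs : s.OrdConnected)
    (h : s ⊆ Iic (Γ.len e)) : IsPreconnected (Γ.pt e '' s) :=
  hs.isPreconnected.image _ ((continuousOn_pt e).mono h)

theorem isPreconnected_closedEdge (e : Γ.E) : IsPreconnected (Γ.closedEdge e) :=
  isPreconnected_pt_image e ordConnected_Iic le_rfl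

theorem pt_mem_closedEdge (e : Γ.E) {t : ℝ≥0∞} (ht : t ≤ Γ.len e) : Γ.pt e t ∈ Γ.closedEdge e :=
  ⟨t, ht, rfl⟩

theorem src_mem_closedEdge (e : Γ.E) : Point.vertex (Γ.src e) ∈ Γ.closedEdge e :=
  ⟨0, mem_Iic.2 zero_le, pt_zero e⟩

theorem tgt_mem_closedEdge (e : Γ.E) : Point.vertex (Γ.tgt e) ∈ Γ.closedEdge e :=
  ⟨_, mem_Iic.2 le_rfl, pt_len e⟩

theorem inner_mem_closedEdge_iff {e f : Γ.E} {t : ℝ≥0∞} (h0 : 0 < t) (h1 : t < Γ.len e) :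
    Point.inner e t h0 h1 ∈ Γ.closedEdge f ↔ f = e := by
  constructor
  · rintro ⟨s, -, h⟩
    exact (edge_eq_of_pt_eq h0 h1 ((pt_of_lt e h0 h1).trans h.symm)).1
  · rintro rfl
    exact ⟨t, h1.le, pt_of_lt _ h0 h1⟩

theorem isClosed_closedEdge (e : Γ.E) : IsClosed (Γ.closedEdge e) := by
  rw [isClosed_iff]
  intro f
  by_cases hf : e = f
  · subst hf
    convert isClosed_univ
    ext t
    simp [pt_mem_closedEdge e t.2]
  · refine Set.Finite.isClosed ?_
    refine Set.Finite.subset (Set.toFinite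
      ({⟨0, mem_Iic.2 zero_le⟩, ⟨Γ.len f, mem_Iic.2 le_rfl⟩} : Set (Iic (Γ.len f)))) ?_
    rintro ⟨t, ht⟩ h
    rcases eq_or_eq_or_lt f ht with rfl | rfl | ⟨h0, h1⟩
    · simp
    · simp
    · rw [mem_preimage, pt_of_lt f h0 h1, inner_mem_closedEdge_iff] at h
      exact (hf h).elim

theorem nontrivial_Iic (e : Γ.E) : Nontrivial (Iic (Γ.len e)) :=
  ⟨⟨0, mem_Iic.2 zero_le⟩, ⟨Γ.len e, mem_Iic.2 le_rfl⟩,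
    fun h => (Γ.len_pos e).ne (congrArg Subtype.val h)⟩

/-- A closed set that contains all but finitely many points of a closed edge contains the
edge. -/
theorem closedEdge_subset_of_diff_finite (e : Γ.E) {B Z : Set Γ.Point} (hB : B.Finite)
    (hZ : IsClosed Z) (h : Γ.closedEdge e \ B ⊆ Z) : Γ.closedEdge e ⊆ Z := by
  have := nontrivial_Iic e
  have : ConnectedSpace (Iic (Γ.len e)) :=
    Subtype.connectedSpace ⟨⟨0, mem_Iic.2 zero_le⟩, isPreconnected_Iic⟩
  have hfin : ((fun t : Iic (Γ.len e) => Γ.pt e t) ⁻¹' B).Finite :=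
    hB.preimage fun s _ t _ hst => Subtype.ext (pt_injOn e s.2 t.2 hst)
  have hd : Dense ((fun t : Iic (Γ.len e) => Γ.pt e t) ⁻¹' B)ᶜ := by
    have := (dense_univ (X := Iic (Γ.len e))).sdiff_finite hfin
    rwa [← compl_eq_univ_sdiff] at this
  have hcl := hZ.preimage (continuous_pt e)
  rintro _ ⟨t, ht, rfl⟩
  exact hcl.closure_subset_iff.2 (fun s hs => h ⟨pt_mem_closedEdge e s.2, hs⟩)
    (hd (⟨t, ht⟩ : Iic (Γ.len e)))

/-! ### Separation and connectedness after removal of finitely many points -/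

/-- Removing two inner points of the same edge disconnects the graph. -/
theorem not_isPreconnected_compl_pair (e : Γ.E) {s t : ℝ≥0∞} (h0 : 0 < s) (h1 : s < t)
    (h2 : t < Γ.len e) : ¬ IsPreconnected ({Γ.pt e s, Γ.pt e t}ᶜ : Set Γ.Point) := by
  intro hc
  have key : ∀ f, ∀ u : Iic (Γ.len f), Γ.pt f u ∈ Γ.pt e '' Ioo s t ↔
      f = e ∧ (u : ℝ≥0∞) ∈ Ioo s t := by
    intro f u
    constructor
    · rintro ⟨w, hw, h⟩
      obtain ⟨rfl, h'⟩ := edge_eq_of_pt_eq (h0.trans hw.1) (hw.2.trans h2) h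
      exact ⟨rfl, h' ▸ hw⟩
    · rintro ⟨rfl, h⟩
      exact ⟨u, h, rfl⟩
  have key' : ∀ f, ∀ u : Iic (Γ.len f), Γ.pt f u ∈ Γ.pt e '' Icc s t ↔
      f = e ∧ (u : ℝ≥0∞) ∈ Icc s t := by
    intro f u
    constructor
    · rintro ⟨w, hw, h⟩
      obtain ⟨rfl, h'⟩ := edge_eq_of_pt_eq (h0.trans_le hw.1) (hw.2.trans_lt h2) h
      exact ⟨rfl, h' ▸ hw⟩
    · rintro ⟨rfl, h⟩
      exact ⟨u, h, rfl⟩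
  have hU : IsOpen (Γ.pt e '' Ioo s t) := by
    rw [isOpen_iff]
    intro f
    by_cases hf : f = e
    · subst hf
      have : (fun u : Iic (Γ.len f) => Γ.pt f u) ⁻¹' (Γ.pt f '' Ioo s t) =
          Subtype.val ⁻¹' Ioo s t := by
        ext u
        simp only [mem_preimage, key, true_and]
      rw [this]
      exact isOpen_Ioo.preimage continuous_subtype_val
    · convert isOpen_empty
      ext u
      simp only [mem_preimage, key, hf, false_and, mem_empty_iff_false]
  have hV : IsClosed (Γ.pt e '' Icc s t) := by
    rw [isClosed_iff]
    intro f
    by_cases hf : f = e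
    · subst hf
      have : (fun u : Iic (Γ.len f) => Γ.pt f u) ⁻¹' (Γ.pt f '' Icc s t) =
          Subtype.val ⁻¹' Icc s t := by
        ext u
        simp only [mem_preimage, key', true_and]
      rw [this]
      exact isClosed_Icc.preimage continuous_subtype_val
    · convert isClosed_empty
      ext u
      simp only [mem_preimage, key', hf, false_and, mem_empty_iff_false]
  have hsl : s < Γ.len e := h1.trans h2
  obtain ⟨m, hm1, hm2⟩ := exists_between h1
  obtain ⟨x, -, hxU, hxV⟩ := hc _ _ hU hV.isOpen_compl (by
    intro x hx
    by_contra h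
    simp only [mem_union, mem_compl_iff, not_or, not_not] at h
    obtain ⟨hn, u, hu, rfl⟩ := h
    simp only [mem_compl_iff, mem_insert_iff, mem_singleton_iff, not_or] at hx
    refine hn ⟨u, ⟨lt_of_le_of_ne hu.1 ?_, lt_of_le_of_ne hu.2 ?_⟩, rfl⟩
    · rintro rfl
      exact hx.1 rfl
    · rintro rfl
      exact hx.2 rfl) ⟨Γ.pt e m, by
        simp only [mem_compl_iff, mem_insert_iff, mem_singleton_iff, not_or]
        refine ⟨fun h => hm1.ne' (pt_inj e (hm2.trans h2).le hsl.le h),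
          fun h => hm2.ne (pt_inj e (hm2.trans h2).le h2.le h)⟩, ⟨m, ⟨hm1, hm2⟩, rfl⟩⟩
      ⟨Γ.pt e 0, by
        simp only [mem_compl_iff, mem_insert_iff, mem_singleton_iff, not_or]
        exact ⟨fun h => h0.ne (pt_inj e zero_le hsl.le h),
          fun h => (h0.trans h1).ne (pt_inj e zero_le h2.le h)⟩, by
        rintro ⟨u, hu, h⟩
        exact (h0.trans_le hu.1).ne' (pt_inj e (hu.2.trans h2.le) zero_le h)⟩
  exact hxV (image_mono Ioo_subset_Icc_self hxU)

/-- The side of a cut that belongs to the set `A` of vertices: the edges in `D` are cut at the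
parameters `c`, and all other edges belong to the side of their end `src`. -/
def side (D : Set Γ.E) (c : Γ.E → ℝ≥0∞) (A : Set Γ.V) : Set Γ.Point
  | .vertex v => v ∈ A
  | .inner e t _ _ => (e ∉ D ∧ Γ.src e ∈ A) ∨
      (e ∈ D ∧ ((t < c e ∧ Γ.src e ∈ A) ∨ (c e < t ∧ Γ.tgt e ∈ A)))

theorem pt_mem_side_iff {D : Set Γ.E} {c : Γ.E → ℝ≥0∞} {A : Set Γ.V}
    (hc : ∀ e ∈ D, 0 < c e ∧ c e < Γ.len e) (hA : ∀ e ∉ D, Γ.src e ∈ A ↔ Γ.tgt e ∈ A)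
    (e : Γ.E) {t : ℝ≥0∞} (ht : t ≤ Γ.len e) :
    Γ.pt e t ∈ side D c A ↔ (e ∉ D ∧ Γ.src e ∈ A) ∨
      (e ∈ D ∧ ((t < c e ∧ Γ.src e ∈ A) ∨ (c e < t ∧ Γ.tgt e ∈ A))) := by
  rcases eq_or_eq_or_lt e ht with rfl | rfl | ⟨h0, h1⟩
  · rw [pt_zero]
    by_cases h : e ∈ D
    · simp [h, (hc e h).1]
      rfl
    · simp [h]
      rfl
  · rw [pt_len]
    by_cases h : e ∈ D
    · have := (hc e h).2
      simp [h, this, this.not_gt]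
      rfl
    · simp [h, hA e h]
      rfl
  · rw [pt_of_lt e h0 h1]
    rfl

theorem isOpen_side {D : Set Γ.E} {c : Γ.E → ℝ≥0∞} {A : Set Γ.V}
    (hc : ∀ e ∈ D, 0 < c e ∧ c e < Γ.len e) (hA : ∀ e ∉ D, Γ.src e ∈ A ↔ Γ.tgt e ∈ A) :
    IsOpen (side D c A) := by
  rw [isOpen_iff]
  intro e
  have : (fun t : Iic (Γ.len e) => Γ.pt e t) ⁻¹' side D c A = Subtype.val ⁻¹'
      {t | (e ∉ D ∧ Γ.src e ∈ A) ∨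
        (e ∈ D ∧ ((t < c e ∧ Γ.src e ∈ A) ∨ (c e < t ∧ Γ.tgt e ∈ A)))} := by
    ext t
    exact pt_mem_side_iff hc hA e t.2
  rw [this]
  refine IsOpen.preimage continuous_subtype_val ?_
  change IsOpen ({t : ℝ≥0∞ | e ∉ D ∧ Γ.src e ∈ A} ∪ ({t | e ∈ D} ∩
    ((Iio (c e) ∩ {t | Γ.src e ∈ A}) ∪ (Ioi (c e) ∩ {t | Γ.tgt e ∈ A}))))
  exact isOpen_const.union (isOpen_const.inter
    ((isOpen_Iio.inter isOpen_const).union (isOpen_Ioi.inter isOpen_const)))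

/-- Cutting one point out of each edge in `D` disconnects the graph, if no other edge joins the
set `A` of vertices to its complement. -/
theorem not_isPreconnected_of_cut (D : Set Γ.E) (c : Γ.E → ℝ≥0∞) (A : Set Γ.V)
    (hc : ∀ e ∈ D, 0 < c e ∧ c e < Γ.len e) (hA : ∀ e ∉ D, Γ.src e ∈ A ↔ Γ.tgt e ∈ A)
    (hne : A.Nonempty) (hne' : Aᶜ.Nonempty) {F : Set Γ.Point}
    (hF : F = (fun e => Γ.pt e (c e)) '' D) : ¬ IsPreconnected Fᶜ := by
  intro hpre
  have hA' : ∀ e ∉ D, Γ.src e ∈ Aᶜ ↔ Γ.tgt e ∈ Aᶜ := fun e he => not_congr (hA e he)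
  have hv : ∀ v, Point.vertex v ∉ F := by
    rw [hF]
    rintro v ⟨e, he, h⟩
    simp only [pt_of_lt e (hc e he).1 (hc e he).2] at h
    cases h
  obtain ⟨v, hvA⟩ := hne
  obtain ⟨w, hwA⟩ := hne'
  obtain ⟨x, -, hx1, hx2⟩ := hpre _ _ (isOpen_side hc hA) (isOpen_side hc hA') (by
    intro x hx
    obtain ⟨e, t, ht, rfl⟩ := exists_pt_eq x
    rw [mem_union, pt_mem_side_iff hc hA e ht, pt_mem_side_iff hc hA' e ht]
    by_cases he : e ∈ D
    · have hne : t ≠ c e := by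
        rintro rfl
        exact hx (hF ▸ ⟨e, he, rfl⟩)
      simp only [he, not_true_eq_false, false_and, true_and, false_or, mem_compl_iff]
      rcases hne.lt_or_gt with h | h
      · tauto
      · tauto
    · simp only [he, not_false_eq_true, false_and, true_and, or_false, mem_compl_iff]
      tauto) ⟨_, hv v, hvA⟩ ⟨_, hv w, hwA⟩
  obtain ⟨e, t, ht, rfl⟩ := exists_pt_eq x
  rw [pt_mem_side_iff hc hA e ht] at hx1
  rw [pt_mem_side_iff hc hA' e ht] at hx2
  simp only [mem_compl_iff] at hx2
  have : ¬ (t < c e ∧ c e < t) := fun h => (h.1.trans h.2).false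
  tauto

/-- If an edge `j` has the same ends as an edge `k` that does not meet `F`, and contains at most
one point of `F`, then its points outside `F` are connected to the ends in the complement
of `F`. -/
theorem exists_isPreconnected_of_parallel {F : Set Γ.Point} {j k : Γ.E}
    (hs : Γ.src j = Γ.src k) (ht : Γ.tgt j = Γ.tgt k) (hk : Γ.closedEdge k ⊆ Fᶜ)
    (hj : (F ∩ Γ.closedEdge j).Subsingleton) {y : Γ.Point} (hy : y ∈ Γ.closedEdge j)
    (hyF : y ∉ F) :
    ∃ C ⊆ Fᶜ, Point.vertex (Γ.src k) ∈ C ∧ y ∈ C ∧ IsPreconnected C := by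
  obtain ⟨t, htl, rfl⟩ := hy
  rw [mem_Iic] at htl
  by_cases h : ∃ s ≤ t, Γ.pt j s ∈ F
  · obtain ⟨s, hst, hsF⟩ := h
    have hne : s < t := lt_of_le_of_ne hst (by rintro rfl; exact hyF hsF)
    refine ⟨Γ.pt j '' Icc t (Γ.len j) ∪ Γ.closedEdge k, union_subset ?_ hk,
      Or.inr (src_mem_closedEdge k), Or.inl ⟨t, ⟨le_rfl, htl⟩, rfl⟩, ?_⟩
    · rintro _ ⟨u, hu, rfl⟩ huF
      have := hj ⟨hsF, pt_mem_closedEdge j (hst.trans htl)⟩ ⟨huF, pt_mem_closedEdge j hu.2⟩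
      exact (hne.trans_le hu.1).ne (pt_inj j (hst.trans htl) hu.2 this)
    · refine IsPreconnected.union (Point.vertex (Γ.tgt k)) ?_ (tgt_mem_closedEdge k)
        (isPreconnected_pt_image j ordConnected_Icc fun u hu => hu.2)
        (isPreconnected_closedEdge k)
      exact ⟨Γ.len j, ⟨htl, le_rfl⟩, by rw [pt_len, ht]⟩
  · push Not at h
    refine ⟨Γ.pt j '' Iic t, ?_, ⟨0, mem_Iic.2 zero_le, by rw [pt_zero, hs]⟩,
      ⟨t, mem_Iic.2 le_rfl, rfl⟩,
      isPreconnected_pt_image j ordConnected_Iic fun u hu => le_trans hu htl⟩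
    rintro _ ⟨u, hu, rfl⟩
    exact h u hu

/-! ### Genus and cut points -/

/-- If the edges outside `D` connect all vertices, then there are at least `|V| - 1` of them. -/
theorem card_vertices_le (D : Set Γ.E)
    (h : ∀ v w, Relation.EqvGen (fun a b => ∃ e ∉ D, Γ.src e = a ∧ Γ.tgt e = b) v w) :
    Nat.card Γ.V ≤ (Dᶜ).ncard + 1 := by
  have := Γ.finV
  have := Γ.finE
  let G : SimpleGraph Γ.V := SimpleGraph.fromRel (fun a b => ∃ e ∉ D, Γ.src e = a ∧ Γ.tgt e = b)
  have hreach : ∀ v w, G.Reachable v w := by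
    intro v w
    induction h v w with
    | rel a b h =>
      obtain ⟨e, he, rfl, rfl⟩ := h
      exact SimpleGraph.Adj.reachable
        ((SimpleGraph.fromRel_adj _ _ _).2 ⟨Γ.src_ne_tgt e, Or.inl ⟨e, he, rfl, rfl⟩⟩)
    | refl a => exact SimpleGraph.Reachable.refl a
    | symm _ _ _ ih => exact ih.symm
    | trans _ _ _ _ _ ih1 ih2 => exact ih1.trans ih2
  obtain ⟨e₀⟩ := Γ.neE
  have hG : G.Connected := { preconnected := hreach, nonempty := ⟨Γ.src e₀⟩ }
  refine hG.card_vert_le_card_edgeSet_add_one.trans (Nat.add_le_add_right ?_ 1)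
  have hsub : G.edgeSet ⊆ (fun e => s(Γ.src e, Γ.tgt e)) '' Dᶜ := by
    intro z
    induction z using Sym2.ind with
    | h a b =>
      intro hz
      obtain ⟨-, ⟨e, he, rfl, rfl⟩ | ⟨e, he, rfl, rfl⟩⟩ :=
        (SimpleGraph.fromRel_adj _ _ _).1 ((SimpleGraph.mem_edgeSet _).1 hz)
      · exact ⟨e, he, rfl⟩
      · exact ⟨e, he, Sym2.eq_swap⟩
  exact (Set.ncard_le_ncard hsub (Set.toFinite _)).trans (Set.ncard_image_le (Set.toFinite _))

/-- In a graph of genus `1`, removing any two points that are not vertices disconnects. -/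
theorem not_isPreconnected_compl_pair_of_genus_eq_one (hg : Γ.genus = 1) {x y : Γ.Point}
    (hxy : x ≠ y) (hx : ∀ v, x ≠ Point.vertex v) (hy : ∀ v, y ≠ Point.vertex v) :
    ¬ IsPreconnected ({x, y}ᶜ : Set Γ.Point) := by
  have := Γ.finV
  have := Γ.finE
  rcases x with v | ⟨e, s, hs0, hs1⟩
  · exact (hx v rfl).elim
  rcases y with v | ⟨f, t, ht0, ht1⟩
  · exact (hy v rfl).elim
  rw [← pt_of_lt, ← pt_of_lt] at hxy ⊢
  by_cases hef : e = f
  · subst hef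
    rcases lt_trichotomy s t with h | rfl | h
    · exact not_isPreconnected_compl_pair e hs0 h ht1
    · exact (hxy rfl).elim
    · rw [pair_comm]
      exact not_isPreconnected_compl_pair e ht0 h hs1
  · classical
    set D : Set Γ.E := {e, f} with hD
    have hcard : ¬ Nat.card Γ.V ≤ (Dᶜ).ncard + 1 := by
      have h1 := Set.ncard_add_ncard_compl D
      rw [hD, Set.ncard_pair hef, ← hD] at h1
      unfold genus at hg
      omega
    have hcon := mt (card_vertices_le D) hcard
    push Not at hcon
    obtain ⟨v, w, hvw⟩ := hcon
    refine not_isPreconnected_of_cut D (fun j => if j = e then s else t)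
      {u | Relation.EqvGen (fun a b => ∃ e ∉ D, Γ.src e = a ∧ Γ.tgt e = b) v u} ?_ ?_
      ⟨v, .refl v⟩ ⟨w, hvw⟩ ?_
    · rintro j (rfl | rfl)
      · simp [hs0, hs1]
      · simp [ht0, ht1, Ne.symm hef]
    · intro j hj
      have h : Relation.EqvGen (fun a b => ∃ e ∉ D, Γ.src e = a ∧ Γ.tgt e = b)
        (Γ.src j) (Γ.tgt j) := .rel _ _ ⟨j, hj, rfl, rfl⟩
      exact ⟨fun h' => .trans _ _ _ h' h, fun h' => .trans _ _ _ h' (.symm _ _ h)⟩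
    · rw [hD, image_pair]
      simp [Ne.symm hef]

/-! ### Path metric -/

theorem segDist_pt_le (e : Γ.E) {s t : ℝ≥0∞} (hs : s ≤ Γ.len e) (ht : t ≤ Γ.len e) :
    Γ.segDist (Γ.pt e s) (Γ.pt e t) ≤ (s - t) + (t - s) :=
  iInf_le_of_le e <| iInf_le_of_le s <| iInf_le_of_le t <| iInf_le_of_le hs <|
    iInf_le_of_le ht <| iInf_le_of_le rfl <| iInf_le _ rfl

theorem le_segDist {x y : Γ.Point} {a : ℝ≥0∞}
    (h : ∀ e, ∀ s ≤ Γ.len e, ∀ t ≤ Γ.len e, Γ.pt e s = x → Γ.pt e t = y →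
      a ≤ (s - t) + (t - s)) : a ≤ Γ.segDist x y :=
  le_iInf fun e => le_iInf fun s => le_iInf fun t => le_iInf fun hs => le_iInf fun ht =>
    le_iInf fun hx => le_iInf fun hy => h e s hs t ht hx hy

theorem segDist_self (x : Γ.Point) : Γ.segDist x x = 0 := by
  obtain ⟨e, t, ht, rfl⟩ := exists_pt_eq x
  simpa using segDist_pt_le e ht ht

theorem pathDist_le_segDist (x y : Γ.Point) : Γ.pathDist x y ≤ Γ.segDist x y :=
  iInf_le_of_le [] le_rfl

/-- A map that does not increase distances inside the closed edges is `1`-Lipschitz for the path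
metrics. -/
theorem pathDist_le_of_segDist_le {f : Γ.Point → Δ.Point}
    (hf : ∀ x y, Δ.segDist (f x) (f y) ≤ Γ.segDist x y) (x y : Γ.Point) :
    Δ.pathDist (f x) (f y) ≤ Γ.pathDist x y := by
  have key : ∀ (l : List Γ.Point) (x : Γ.Point),
      Δ.chainLength (f x) (l.map f) (f y) ≤ Γ.chainLength x l y := by
    intro l
    induction l with
    | nil => exact fun x => hf x y
    | cons z l ih => exact fun x => add_le_add (hf x z) (ih z)
  exact le_iInf fun l => (iInf_le _ (l.map f)).trans (key l x)

/-- A function that is `1`-Lipschitz on the closed edges is `1`-Lipschitz for the path metric. -/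
theorem le_add_pathDist {g : Γ.Point → ℝ≥0∞}
    (hg : ∀ x y, g x ≤ g y + Γ.segDist x y) (x y : Γ.Point) : g x ≤ g y + Γ.pathDist x y := by
  have key : ∀ (l : List Γ.Point) (x : Γ.Point), g x ≤ g y + Γ.chainLength x l y := by
    intro l
    induction l with
    | nil => exact fun x => hg x y
    | cons z l ih =>
      intro x
      refine (hg x z).trans ((add_le_add_left (ih z) _).trans_eq ?_)
      simp only [chainLength]
      ring
  unfold pathDist
  rw [ENNReal.add_iInf]
  exact le_iInf fun l => key l x

/-! ### The involution of a harmonic morphism of degree two -/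

theorem eq_of_isDilation {φ : Γ'.Point → Γ.Point} {e' : Γ'.E} {e : Γ.E} {k l : ℕ} {r s : Bool}
    (h : IsDilation φ e' e k r) (h' : IsDilation φ e' e l s) : r = s := by
  have key : ∀ {k l : ℕ}, IsDilation φ e' e k false → IsDilation φ e' e l true → False := by
    rintro k l ⟨-, -, ⟨-, h1⟩ | ⟨h1, -⟩⟩ ⟨-, -, ⟨h2, -⟩ | ⟨-, -, h2⟩⟩
    · cases h2
    · have := (h1 0 zero_le).symm.trans (h2 0 zero_le)
      simp only [mul_zero, tsub_zero] at this
      exact (Γ.len_pos e).ne (pt_inj e zero_le le_rfl this)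
    · cases h1
    · cases h1
  cases r <;> cases s
  · rfl
  · exact (key h h').elim
  · exact (key h' h).elim
  · rfl

theorem exists_mem_tangent (e : Γ.E) {t : ℝ≥0∞} (ht : t ≤ Γ.len e) :
    ∃ b, (e, b) ∈ Γ.tangent (Γ.pt e t) := by
  rcases ht.eq_or_lt with rfl | h
  · exact ⟨false, _, le_rfl, rfl, Or.inr ⟨rfl, Γ.len_pos e⟩⟩
  · exact ⟨true, t, ht, rfl, Or.inl ⟨rfl, h⟩⟩

theorem mapsTangent_mem {φ : Γ'.Point → Γ.Point} {e' : Γ'.E} {e : Γ.E} {k : ℕ} {r b : Bool}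
    (h : IsDilation φ e' e k r) {P : Γ'.Point} (hb : (e', b) ∈ Γ'.tangent P) :
    (e, xor b r) ∈ Γ.tangent (φ P) := by
  obtain ⟨hk, hlen, h⟩ := h
  obtain ⟨t, ht, rfl, hb⟩ := hb
  have hk0 : (k : ℝ≥0∞) ≠ 0 := by exact_mod_cast hk.ne'
  have hkt : (k : ℝ≥0∞) ≠ ∞ := ENNReal.natCast_ne_top k
  have hle : (k : ℝ≥0∞) * t ≤ Γ.len e := hlen ▸ mul_le_mul_right ht _
  have hlt : t < Γ'.len e' → (k : ℝ≥0∞) * t < Γ.len e := fun h =>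
    hlen ▸ ENNReal.mul_lt_mul_right hk0 hkt h
  have hpos : 0 < t → 0 < (k : ℝ≥0∞) * t := fun h => ENNReal.mul_pos hk0 h.ne'
  rcases h with ⟨rfl, h⟩ | ⟨rfl, hfin, h⟩
  · refine ⟨_, hle, (h t ht).symm, ?_⟩
    simp only [Bool.xor_false] at hb ⊢
    exact hb.imp (And.imp_right hlt) (And.imp_right hpos)
  · refine ⟨_, tsub_le_self, (h t ht).symm, ?_⟩
    simp only [Bool.xor_true] at hb ⊢
    rcases hb with ⟨rfl, hb⟩ | ⟨rfl, hb⟩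
    · exact Or.inr ⟨rfl, tsub_pos_of_lt (hlt hb)⟩
    · exact Or.inl ⟨rfl, ENNReal.sub_lt_self hfin (Γ.len_pos e).ne' (hpos hb).ne'⟩

/-- A sum of positive natural numbers with value two has either one or two terms. -/
theorem eq_two_or_exists_of_finsum_mem_eq_two {α : Type*} {S : Set α} {f : α → ℕ}
    (hf : ∀ a ∈ S, 1 ≤ f a) (h : ∑ᶠ a ∈ S, f a = 2) {a : α} (ha : a ∈ S) :
    (f a = 2 ∧ ∀ b ∈ S, b = a) ∨
      (f a = 1 ∧ ∃ b ∈ S, b ≠ a ∧ f b = 1 ∧ ∀ c ∈ S, c = a ∨ c = b) := by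
  classical
  have hfin : S.Finite := by
    by_contra hinf
    have hS : S ∩ Function.support f = S := by
      ext b
      simp only [mem_inter_iff, Function.mem_support, and_iff_left_iff_imp]
      exact fun hb => (Nat.one_le_iff_ne_zero.1 (hf b hb))
    rw [finsum_mem_eq_zero_of_infinite (hS.symm ▸ hinf)] at h
    cases h
  lift S to Finset α using hfin
  rw [finsum_mem_coe_finset, ← Finset.add_sum_erase _ _ ha] at h
  simp only [Finset.mem_coe] at hf ha ⊢
  have ha1 := hf a ha
  rcases (S.erase a).eq_empty_or_nonempty with he | ⟨b, hb⟩
  · left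
    rw [he, Finset.sum_empty] at h
    refine ⟨h, fun b hb => ?_⟩
    by_contra hne
    exact (Finset.notMem_empty b) (he ▸ Finset.mem_erase.2 ⟨hne, hb⟩)
  · right
    rw [← Finset.add_sum_erase _ _ hb] at h
    have hb' := Finset.mem_erase.1 hb
    have hb1 := hf b hb'.2
    refine ⟨by omega, b, hb'.2, hb'.1, by omega, fun c hc => ?_⟩
    by_contra! hne
    have hc' : c ∈ (S.erase a).erase b := Finset.mem_erase.2 ⟨hne.2, Finset.mem_erase.2 ⟨hne.1, hc⟩⟩
    have := Finset.single_le_sum (f := f) (fun _ _ => Nat.zero_le _) hc'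
    have := hf c hc
    omega

section Harmonic

variable {φ : Γ'.Point → Γ.Point} {d : Γ'.E → ℕ} {m : Γ'.Point → ℕ}

theorem exists_isDilation (hM : IsModelMorphism φ d) (hd : ∀ e', 0 < d e') (e' : Γ'.E) :
    ∃ e r, IsDilation φ e' e (d e') r := by
  rcases hM.edge e' with ⟨h, -⟩ | h
  · exact ((hd e').ne' h).elim
  · exact h

/-- The local degree bounds the sum of the degrees along tangent directions that are mapped to
one and the same direction. -/
theorem sum_le_of_isHarmonicAt {P : Γ'.Point} {n : ℕ} (h : IsHarmonicAt φ d P n)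
    {v : Γ.E × Bool} (hv : v ∈ Γ.tangent (φ P)) (T : Finset (Γ'.E × Bool))
    (hT : ∀ v' ∈ T, v' ∈ Γ'.tangent P ∧ MapsTangent φ d v' v) : ∑ v' ∈ T, d v'.1 ≤ n := by
  classical
  have := Γ'.finE
  rw [← h v hv, finsum_mem_eq_finite_toFinset_sum _ (Set.toFinite _)]
  refine Finset.sum_le_sum_of_subset fun v' hv' => ?_
  simpa using hT v' hv'

/-- At an inner point of an edge, the local degree is the degree along the edge. -/
theorem localDegree_inner (hM : IsModelMorphism φ d) (hd : ∀ e', 0 < d e')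
    (hm : ∀ P, IsHarmonicAt φ d P (m P)) (e' : Γ'.E) {t : ℝ≥0∞} (h0 : 0 < t)
    (h1 : t < Γ'.len e') : m (Γ'.pt e' t) = d e' := by
  obtain ⟨e, r, hr⟩ := exists_isDilation hM hd e'
  have htan : (e', true) ∈ Γ'.tangent (Γ'.pt e' t) := ⟨t, h1.le, rfl, Or.inl ⟨rfl, h1⟩⟩
  rw [← hm _ _ (mapsTangent_mem hr htan)]
  have : {v' | v' ∈ Γ'.tangent (Γ'.pt e' t) ∧ MapsTangent φ d v' (e, xor true r)} =
      {(e', true)} := by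
    ext ⟨f, b⟩
    simp only [mem_ofPred_eq, mem_singleton_iff]
    constructor
    · rintro ⟨⟨s, hs, hst, -⟩, r', hr', hb⟩
      obtain rfl := (edge_eq_of_pt_eq h0 h1 hst.symm).1
      obtain rfl := eq_of_isDilation hr hr'
      have hb' : b = true := by cases b <;> cases r <;> simp_all
      rw [hb']
    · intro h
      cases h
      exact ⟨htan, r, hr, rfl⟩
  rw [this, finsum_mem_singleton]

theorem degree_le_localDegree (hM : IsModelMorphism φ d) (hd : ∀ e', 0 < d e')
    (hm : ∀ P, IsHarmonicAt φ d P (m P)) (e' : Γ'.E) {t : ℝ≥0∞} (ht : t ≤ Γ'.len e') :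
    d e' ≤ m (Γ'.pt e' t) := by
  obtain ⟨e, r, hr⟩ := exists_isDilation hM hd e'
  obtain ⟨b, hb⟩ := exists_mem_tangent e' ht
  have := sum_le_of_isHarmonicAt (hm _) (mapsTangent_mem hr hb) {(e', b)} (by
    simp only [Finset.mem_singleton, forall_eq]
    exact ⟨hb, r, hr, rfl⟩)
  simpa using this

/-- Two edges of degree one over the same edge, matched by their parametrizations: over each
point, either the points on the two edges are different, or they are the same and the local degree
is at least two. -/
theorem exists_parallel_edge (hm : ∀ P, IsHarmonicAt φ d P (m P)) {e' f' : Γ'.E} {e : Γ.E}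
    {r s : Bool} (hne : e' ≠ f') (he : d e' = 1) (hf : d f' = 1)
    (hr : IsDilation φ e' e (d e') r) (hs : IsDilation φ f' e (d f') s) :
    Γ'.len f' = Γ'.len e' ∧ ∃ u : ℝ≥0∞ → ℝ≥0∞, ((∀ t, u t = t) ∨
      (Γ'.len e' ≠ ∞ ∧ ∀ t, u t = Γ'.len e' - t)) ∧ ∀ t ≤ Γ'.len e',
        φ (Γ'.pt f' (u t)) = φ (Γ'.pt e' t) ∧
        (Γ'.pt f' (u t) = Γ'.pt e' t → 2 ≤ m (Γ'.pt e' t)) := by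
  have hlr : Γ'.len e' = Γ.len e := by simpa [he] using hr.2.1
  have hls : Γ'.len f' = Γ.len e := by simpa [hf] using hs.2.1
  have hl : Γ'.len f' = Γ'.len e' := hls.trans hlr.symm
  -- Matching directions along both edges that leave a common point give local degree two.
  have key : ∀ {t u : ℝ≥0∞} {b : Bool}, (e', b) ∈ Γ'.tangent (Γ'.pt e' t) →
      (f', xor b (xor r s)) ∈ Γ'.tangent (Γ'.pt f' u) → Γ'.pt f' u = Γ'.pt e' t →
      2 ≤ m (Γ'.pt e' t) := by
    classical
    intro t u b hb hb' heq
    have := sum_le_of_isHarmonicAt (hm _) (mapsTangent_mem hr hb)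
      {(e', b), (f', xor b (xor r s))} (by
        intro v' hv'
        simp only [Finset.mem_insert, Finset.mem_singleton] at hv'
        rcases hv' with rfl | rfl
        · exact ⟨hb, r, hr, rfl⟩
        · refine ⟨heq ▸ hb', s, hs, ?_⟩
          simp)
    rw [Finset.sum_pair (by simp [hne])] at this
    simpa [he, hf] using this
  refine ⟨hl, ?_⟩
  by_cases hrs : r = s
  · subst hrs
    refine ⟨id, Or.inl fun _ => rfl, fun t ht => ⟨?_, fun heq => ?_⟩⟩
    · rcases hr.2.2 with ⟨hr0, hr⟩ | ⟨hr0, -, hr⟩ <;>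
        rcases hs.2.2 with ⟨hs0, hs⟩ | ⟨hs0, -, hs⟩
      · rw [hr t ht, id, hs t (hl ▸ ht), he, hf]
      · exact (Bool.false_ne_true (hr0.symm.trans hs0)).elim
      · exact (Bool.false_ne_true (hs0.symm.trans hr0)).elim
      · rw [hr t ht, id, hs t (hl ▸ ht), he, hf]
    · obtain ⟨b, hb⟩ := exists_mem_tangent e' ht
      refine key hb (u := t) ?_ heq
      obtain ⟨t', ht', htt, hb⟩ := hb
      obtain rfl := pt_inj e' ht' ht htt
      simp only [Bool.xor_self, Bool.xor_false]
      exact ⟨t', hl ▸ ht, rfl, hl.symm ▸ hb⟩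
  · have hfin : Γ'.len e' ≠ ∞ := by
      rw [hlr]
      rcases hr.2.2 with ⟨hr0, -⟩ | ⟨-, h, -⟩
      · rcases hs.2.2 with ⟨hs0, -⟩ | ⟨-, h, -⟩
        · exact (hrs (hr0.trans hs0.symm)).elim
        · exact h
      · exact h
    have hxor : xor r s = true := by
      cases r <;> cases s <;> simp_all
    refine ⟨fun t => Γ'.len e' - t, Or.inr ⟨hfin, fun _ => rfl⟩, fun t ht => ⟨?_, fun heq => ?_⟩⟩
    · rcases hr.2.2 with ⟨hr0, hr⟩ | ⟨hr0, -, hr⟩ <;>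
        rcases hs.2.2 with ⟨hs0, hs⟩ | ⟨hs0, -, hs⟩
      · exact (hrs (hr0.trans hs0.symm)).elim
      · rw [hr t ht, hs _ (hl ▸ tsub_le_self), he, hf, ← hlr, Nat.cast_one, one_mul, one_mul,
          ENNReal.sub_sub_cancel hfin ht]
      · rw [hr t ht, hs _ (hl ▸ tsub_le_self), he, hf, ← hlr, Nat.cast_one, one_mul, one_mul]
      · exact (hrs (hr0.trans hs0.symm)).elim
    · obtain ⟨b, hb⟩ := exists_mem_tangent e' ht
      refine key hb ?_ heq
      obtain ⟨t', ht', htt, hb⟩ := hb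
      obtain rfl := pt_inj e' ht' ht htt
      rw [hxor, Bool.xor_true]
      refine ⟨_, hl ▸ tsub_le_self, rfl, ?_⟩
      rcases hb with ⟨rfl, hb⟩ | ⟨rfl, hb⟩
      · exact Or.inr ⟨rfl, tsub_pos_of_lt hb⟩
      · exact Or.inl ⟨rfl, hl.symm ▸ ENNReal.sub_lt_self hfin (Γ'.len_pos e').ne' hb.ne'⟩

/-- The involution of a model of a finite harmonic morphism of degree two. It maps each edge to an
edge of the same length, preserving or reversing the parametrization. -/
theorem exists_model_involution (hM : IsModelMorphism φ d) (hd : ∀ e', 0 < d e')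
    (hm : ∀ P, IsHarmonicAt φ d P (m P)) (hdeg : ∀ P, ∑ᶠ P' ∈ φ ⁻¹' {P}, m P' = 2) :
    ∃ ι : Γ'.Point → Γ'.Point, (∀ P Q, φ Q = φ P ↔ Q = P ∨ Q = ι P) ∧ (∀ P, ι (ι P) = P) ∧
      ∀ e', ∃ (f' : Γ'.E) (u : ℝ≥0∞ → ℝ≥0∞), Γ'.len f' = Γ'.len e' ∧ ((∀ t, u t = t) ∨
        (Γ'.len e' ≠ ∞ ∧ ∀ t, u t = Γ'.len e' - t)) ∧
        ∀ t ≤ Γ'.len e', ι (Γ'.pt e' t) = Γ'.pt f' (u t) := by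
  have hm1 : ∀ P, 1 ≤ m P := by
    intro P
    obtain ⟨e', t, ht, rfl⟩ := exists_pt_eq P
    exact (hd e').trans_le (degree_le_localDegree hM hd hm e' ht)
  have hfib : ∀ P, ∃ Q, φ Q = φ P ∧ (∀ R, φ R = φ P → R = P ∨ R = Q) ∧
      (m P = 1 ∧ Q ≠ P ∧ m Q = 1 ∨ m P = 2 ∧ Q = P) := by
    intro P
    rcases eq_two_or_exists_of_finsum_mem_eq_two (fun a _ => hm1 a) (hdeg (φ P))
      (show P ∈ φ ⁻¹' {φ P} from rfl) with ⟨h1, h2⟩ | ⟨h1, Q, hQ, hne, hQ1, h2⟩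
    · exact ⟨P, rfl, fun R hR => Or.inl (h2 R hR), Or.inr ⟨h1, rfl⟩⟩
    · exact ⟨Q, hQ, h2, Or.inl ⟨h1, hne, hQ1⟩⟩
  choose ι hι hfib hι' using hfib
  have huniq : ∀ P Q, φ Q = φ P → (Q = P → 2 ≤ m P) → ι P = Q := by
    intro P Q h h'
    rcases hfib P Q h with rfl | h2
    · rcases hι' Q with ⟨h3, -⟩ | ⟨-, h3⟩
      · have := h' rfl
        omega
      · exact h3
    · exact h2.symm
  refine ⟨ι, fun P Q => ⟨hfib P Q, ?_⟩, fun P => ?_, fun e' => ?_⟩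
  · rintro (rfl | rfl)
    · rfl
    · exact hι P
  · rcases hι' P with ⟨-, h, -⟩ | ⟨-, h⟩
    · exact huniq _ _ (hι P).symm fun h' => (h h'.symm).elim
    · rw [h, h]
  · by_cases hd2 : 2 ≤ d e'
    · refine ⟨e', id, rfl, Or.inl fun _ => rfl, fun t ht => huniq _ _ rfl fun _ => ?_⟩
      exact hd2.trans (degree_le_localDegree hM hd hm e' ht)
    · have he1 : d e' = 1 := by have := hd e'; omega
      obtain ⟨t, h0, h1⟩ := exists_between (Γ'.len_pos e')
      obtain ⟨e, r, hr⟩ := exists_isDilation hM hd e'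
      rcases hι' (Γ'.pt e' t) with ⟨-, hne, hm1'⟩ | ⟨h, -⟩
      · -- The other point of the fiber of an inner point lies on the matching edge.
        obtain ⟨f', w, hw, hQ⟩ := exists_pt_eq (ι (Γ'.pt e' t))
        obtain ⟨f, s, hs⟩ := exists_isDilation hM hd f'
        have hf1 : d f' = 1 := by
          have h1 := degree_le_localDegree hM hd hm f' hw
          have h2 := hd f'
          rw [hQ] at h1
          omega
        have himg : ∃ x, 0 < x ∧ x < Γ.len e ∧ φ (Γ'.pt e' t) = Γ.pt e x := by
          have hlr : Γ'.len e' = Γ.len e := by simpa [he1] using hr.2.1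
          rcases hr.2.2 with ⟨-, h⟩ | ⟨-, hfin, h⟩
          · exact ⟨t, h0, hlr ▸ h1, by rw [h t h1.le, he1, Nat.cast_one, one_mul]⟩
          · exact ⟨Γ.len e - t, tsub_pos_of_lt (hlr ▸ h1),
              ENNReal.sub_lt_self hfin (Γ.len_pos e).ne' h0.ne',
              by rw [h t h1.le, he1, Nat.cast_one, one_mul]⟩
        have himg' : ∃ y ≤ Γ.len f, φ (Γ'.pt f' w) = Γ.pt f y ∧ ((s = false ∧ y = w) ∨
            (s = true ∧ Γ.len f ≠ ∞ ∧ y = Γ.len f - w)) := by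
          have hls : Γ'.len f' = Γ.len f := by simpa [hf1] using hs.2.1
          rcases hs.2.2 with ⟨h', h⟩ | ⟨h', hfin, h⟩
          · exact ⟨w, hls ▸ hw, by rw [h w hw, hf1, Nat.cast_one, one_mul], Or.inl ⟨h', rfl⟩⟩
          · exact ⟨Γ.len f - w, tsub_le_self, by rw [h w hw, hf1, Nat.cast_one, one_mul],
              Or.inr ⟨h', hfin, rfl⟩⟩
        obtain ⟨x, hx0, hx1, hx⟩ := himg
        obtain ⟨y, hy1, hy, hyw⟩ := himg'
        have hxy : Γ.pt e x = Γ.pt f y := by rw [← hx, ← hy, hQ, hι]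
        obtain ⟨rfl, hyx⟩ := edge_eq_of_pt_eq hx0 hx1 hxy
        have hne' : e' ≠ f' := by
          rintro rfl
          obtain rfl := eq_of_isDilation hr hs
          refine hne ?_
          rw [← hQ]
          have hls : Γ'.len e' = Γ.len f := by simpa [hf1] using hs.2.1
          -- The point with parameter `t` is the only point of the edge over its image.
          rcases hs.2.2 with ⟨rfl, h⟩ | ⟨rfl, hfin, h⟩
          · have h3 := (h w hw).symm.trans (hy.trans (hxy.symm.trans (hx.symm.trans (h t h1.le))))
            rw [he1, Nat.cast_one, one_mul, one_mul] at h3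
            rw [pt_inj f (hls ▸ hw) (hls ▸ h1.le) h3]
          · have h3 := (h w hw).symm.trans (hy.trans (hxy.symm.trans (hx.symm.trans (h t h1.le))))
            rw [he1, Nat.cast_one, one_mul, one_mul] at h3
            have h4 := pt_inj f tsub_le_self tsub_le_self h3
            have h5 := congrArg (fun z => Γ.len f - z) h4
            beta_reduce at h5
            rw [ENNReal.sub_sub_cancel hfin (hls ▸ hw),
              ENNReal.sub_sub_cancel hfin (hls ▸ h1.le)] at h5
            rw [h5]
        obtain ⟨hl, u, hu, h⟩ := exists_parallel_edge hm hne' he1 hf1 hr hs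
        exact ⟨f', u, hl, hu, fun t ht => huniq _ _ (h t ht).1 (h t ht).2⟩
      · rw [localDegree_inner hM hd hm e' h0 h1] at h
        omega

end Harmonic

/-- An involution that maps each edge to an edge of the same length, preserving or reversing the
parametrization, is an isometric homeomorphism. -/
theorem exists_metricIso_of_edges {ι : Γ.Point → Γ.Point} (hι : ∀ P, ι (ι P) = P)
    (h : ∀ e, ∃ (f : Γ.E) (u : ℝ≥0∞ → ℝ≥0∞), Γ.len f = Γ.len e ∧ ((∀ t, u t = t) ∨
        (Γ.len e ≠ ∞ ∧ ∀ t, u t = Γ.len e - t)) ∧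
        ∀ t ≤ Γ.len e, ι (Γ.pt e t) = Γ.pt f (u t)) :
    ∃ g : MetricIso Γ Γ, ∀ P, g.toHomeo P = ι P := by
  have hcont : Continuous ι := by
    rw [continuous_iff]
    intro e
    obtain ⟨f, u, hl, hu, h⟩ := h e
    have hcu : Continuous u := by
      rcases hu with hu | ⟨hfin, hu⟩
      · exact (funext hu : u = id) ▸ continuous_id
      · exact (funext hu : u = fun t => Γ.len e - t) ▸ ENNReal.continuous_sub_left hfin
    have : (fun t : Iic (Γ.len e) => ι (Γ.pt e t)) = fun t : Iic (Γ.len e) => Γ.pt f (u t) :=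
      funext fun t => h t t.2
    rw [this]
    refine (continuousOn_pt f).comp_continuous (hcu.comp continuous_subtype_val) fun t => ?_
    rw [mem_Iic, hl]
    rcases hu with hu | ⟨-, hu⟩
    · exact (hu t).symm ▸ t.2
    · exact (hu t).symm ▸ tsub_le_self
  have hseg : ∀ x y, Γ.segDist (ι x) (ι y) ≤ Γ.segDist x y := by
    refine fun x y => le_segDist ?_
    rintro e s hs t ht rfl rfl
    obtain ⟨f, u, hl, hu, h⟩ := h e
    rw [h s hs, h t ht]
    rcases hu with hu | ⟨hfin, hu⟩
    · rw [hu, hu]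
      exact segDist_pt_le f (hl ▸ hs) (hl ▸ ht)
    · rw [hu, hu]
      refine (segDist_pt_le f (hl ▸ tsub_le_self) (hl ▸ tsub_le_self)).trans_eq ?_
      rw [ENNReal.sub_sub_sub_cancel_left hfin hs, ENNReal.sub_sub_sub_cancel_left hfin ht,
        add_comm]
  refine ⟨⟨⟨⟨ι, ι, hι, hι⟩, hcont, hcont⟩, fun x y => ?_⟩, fun P => rfl⟩
  refine le_antisymm (pathDist_le_of_segDist_le hseg x y) ?_
  have := pathDist_le_of_segDist_le hseg (ι x) (ι y)
  rwa [hι, hι] at this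

/-- The fibers of a finite harmonic morphism of degree two are the orbits of an isometric
involution. -/
theorem IsFiniteHarmonicMorphism.exists_involution {φ : Γ'.Point → Γ.Point}
    (h : IsFiniteHarmonicMorphism φ 2) :
    Continuous φ ∧ Function.Surjective φ ∧ ∃ ι : MetricIso Γ' Γ',
      (∀ P Q, φ Q = φ P ↔ Q = P ∨ Q = ι.toHomeo P) ∧ ∀ P, ι.toHomeo (ι.toHomeo P) = P := by
  obtain ⟨H', H, h', h, d, m, hM, hd, hsurj, hm, hdeg⟩ := h
  obtain ⟨ι, hfib, hι, hedge⟩ := exists_model_involution hM hd hm hdeg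
  obtain ⟨g, hg⟩ := exists_metricIso_of_edges hι hedge
  have hφ : φ = h.toHomeo ∘ (fun P => h.toHomeo.symm (φ (h'.toHomeo P))) ∘ h'.toHomeo.symm := by
    ext P
    simp
  refine ⟨?_, ?_, ⟨(h'.toHomeo.symm.trans g.toHomeo).trans h'.toHomeo, fun x y => ?_⟩, ?_, ?_⟩
  · rw [hφ]
    exact h.toHomeo.continuous.comp (hM.continuous.comp h'.toHomeo.symm.continuous)
  · rw [hφ]
    exact h.toHomeo.surjective.comp (hsurj.comp h'.toHomeo.symm.surjective)
  · simp only [Homeomorph.trans_apply]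
    rw [h'.pathDist_eq, g.pathDist_eq, ← h'.pathDist_eq]
    simp
  · intro P Q
    have := hfib (h'.toHomeo.symm P) (h'.toHomeo.symm Q)
    simp only [Homeomorph.apply_symm_apply, EmbeddingLike.apply_eq_iff_eq] at this
    rw [this, Homeomorph.trans_apply, Homeomorph.trans_apply, hg,
      ← h'.toHomeo.symm_apply_eq (y := Q)]
  · intro P
    simp [hg, hι]

/-! ### Retractions onto subgraphs -/

/-- An isometric embedding of `Γ` onto a closed subset of `Δ`, with a retraction that collapses
each of the pieces attached to `Γ` to one of finitely many points. -/
structure Retraction (Γ Δ : WeightedGraph) where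
  incl : Γ.Point → Δ.Point
  retr : Δ.Point → Γ.Point
  continuous_incl : Continuous incl
  continuous_retr : Continuous retr
  retr_incl : ∀ x, retr (incl x) = x
  isClosed_range : IsClosed (range incl)
  pathDist_incl : ∀ x y, Δ.pathDist (incl x) (incl y) = Γ.pathDist x y
  finite_image : (retr '' (range incl)ᶜ).Finite
  isPreconnected_fiber : ∀ x, IsPreconnected (retr ⁻¹' {x})

namespace Retraction

/-- The points at which something is attached. -/
def base (R : Retraction Γ Δ) : Set Γ.Point := R.retr '' (range R.incl)ᶜ

theorem incl_injective (R : Retraction Γ Δ) : Function.Injective R.incl :=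
  Function.LeftInverse.injective R.retr_incl

theorem isClosedEmbedding_incl (R : Retraction Γ Δ) : IsClosedEmbedding R.incl :=
  ⟨Function.LeftInverse.isEmbedding R.retr_incl R.continuous_retr R.continuous_incl,
    R.isClosed_range⟩

theorem eq_incl_of_retr_notMem (R : Retraction Γ Δ) {y : Δ.Point} (h : R.retr y ∉ R.base) :
    y = R.incl (R.retr y) := by
  by_contra hne
  refine h ⟨y, ?_, rfl⟩
  rintro ⟨x, rfl⟩
  exact hne (by rw [R.retr_incl])

theorem isPreconnected_preimage (R : Retraction Γ Δ) {C : Set Γ.Point} (hC : IsPreconnected C) :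
    IsPreconnected (R.retr ⁻¹' C) := by
  have h : R.retr ⁻¹' C = ⋃ x : C, (R.incl '' C ∪ R.retr ⁻¹' {x.1}) := by
    ext y
    simp only [mem_preimage, mem_iUnion, mem_union, mem_image, mem_singleton_iff]
    constructor
    · exact fun hy => ⟨⟨_, hy⟩, Or.inr rfl⟩
    · rintro ⟨⟨x, hx⟩, ⟨z, hz, rfl⟩ | h⟩
      · rwa [R.retr_incl]
      · exact h.symm ▸ hx
  rw [h]
  rcases C.eq_empty_or_nonempty with rfl | ⟨c, hc⟩
  · simpa using isPreconnected_empty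
  · refine isPreconnected_iUnion ⟨R.incl c, mem_iInter.2 fun x => Or.inl ⟨c, hc, rfl⟩⟩ fun x => ?_
    exact IsPreconnected.union (R.incl x) ⟨x, x.2, rfl⟩ (R.retr_incl _)
      (hC.image _ R.continuous_incl.continuousOn) (R.isPreconnected_fiber _)

theorem preimage_compl (R : Retraction Γ Δ) {F : Set Γ.Point} (hF : Disjoint F R.base) :
    R.retr ⁻¹' Fᶜ = (R.incl '' F)ᶜ := by
  ext y
  simp only [mem_preimage, mem_compl_iff, mem_image, not_iff_not]
  constructor
  · exact fun hy => ⟨_, hy, (R.eq_incl_of_retr_notMem (disjoint_left.1 hF hy)).symm⟩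
  · rintro ⟨x, hx, rfl⟩
    rwa [R.retr_incl]

/-- Removing points at which nothing is attached disconnects `Δ` exactly if it disconnects `Γ`. -/
theorem isPreconnected_compl_image_iff (R : Retraction Γ Δ) {F : Set Γ.Point}
    (hF : Disjoint F R.base) : IsPreconnected (R.incl '' F)ᶜ ↔ IsPreconnected Fᶜ := by
  rw [← R.preimage_compl hF]
  refine ⟨fun h => ?_, R.isPreconnected_preimage⟩
  have := h.image _ R.continuous_retr.continuousOn
  rwa [image_preimage_eq _ (Function.LeftInverse.surjective R.retr_incl)] at this

/-- The composition of two retractions. -/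
def trans (R : Retraction Γ Δ) (S : Retraction Δ Θ) : Retraction Γ Θ where
  incl := S.incl ∘ R.incl
  retr := R.retr ∘ S.retr
  continuous_incl := S.continuous_incl.comp R.continuous_incl
  continuous_retr := R.continuous_retr.comp S.continuous_retr
  retr_incl x := by simp [R.retr_incl, S.retr_incl]
  isClosed_range := (S.isClosedEmbedding_incl.comp R.isClosedEmbedding_incl).isClosed_range
  pathDist_incl x y := by simp [R.pathDist_incl, S.pathDist_incl]
  finite_image := by
    refine (R.finite_image.union (S.finite_image.image R.retr)).subset ?_
    rintro _ ⟨y, hy, rfl⟩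
    by_cases h : y ∈ range S.incl
    · obtain ⟨z, rfl⟩ := h
      refine Or.inl ⟨z, ?_, by simp [S.retr_incl]⟩
      rintro ⟨x, rfl⟩
      exact hy ⟨x, rfl⟩
    · exact Or.inr ⟨_, ⟨y, h, rfl⟩, rfl⟩
  isPreconnected_fiber x := by
    rw [preimage_comp]
    exact S.isPreconnected_preimage (R.isPreconnected_fiber x)

end Retraction

/-- An isomorphism of metric graphs is a retraction. -/
def MetricIso.retraction (h : MetricIso Γ Δ) : Retraction Γ Δ where
  incl := h.toHomeo
  retr := h.toHomeo.symm
  continuous_incl := h.toHomeo.continuous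
  continuous_retr := h.toHomeo.symm.continuous
  retr_incl := h.toHomeo.symm_apply_apply
  isClosed_range := by simp
  pathDist_incl := h.pathDist_eq
  finite_image := by simp
  isPreconnected_fiber x := by
    have : h.toHomeo.symm ⁻¹' {x} = {h.toHomeo x} := by
      ext y
      simp [Homeomorph.symm_apply_eq]
    rw [this]
    exact isPreconnected_singleton

/-- The inverse of an isomorphism of metric graphs. -/
def MetricIso.symm (h : MetricIso Γ Δ) : MetricIso Δ Γ where
  toHomeo := h.toHomeo.symm
  pathDist_eq x y := by rw [← h.pathDist_eq]; simp

/-- A subgraph, embedded by `iV` and `iE`, such that each edge outside the subgraph starts at a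
vertex of the subgraph; `rV` maps the ends of such an edge to this vertex, and `rE` is the partial
inverse of `iE`. -/
structure Collapse (Γ Δ : WeightedGraph) where
  iV : Γ.V → Δ.V
  iE : Γ.E → Δ.E
  rV : Δ.V → Γ.V
  rE : Δ.E → Option Γ.E
  len_iE : ∀ e, Δ.len (iE e) = Γ.len e
  src_iE : ∀ e, Δ.src (iE e) = iV (Γ.src e)
  tgt_iE : ∀ e, Δ.tgt (iE e) = iV (Γ.tgt e)
  rV_iV : ∀ v, rV (iV v) = v
  rE_iE : ∀ e, rE (iE e) = some e
  rE_eq : ∀ f, (∃ e, iE e = f) ∨ rE f = none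
  iV_rV_src : ∀ f, rE f = none → iV (rV (Δ.src f)) = Δ.src f
  rV_tgt : ∀ f, rE f = none → rV (Δ.tgt f) = rV (Δ.src f)

namespace Collapse

variable (C : Collapse Γ Δ)

/-- The inclusion of the subgraph. -/
def incl : Γ.Point → Δ.Point
  | .vertex v => .vertex (C.iV v)
  | .inner e t _ _ => Δ.pt (C.iE e) t

/-- The map that collapses the edges outside the subgraph. -/
def retr : Δ.Point → Γ.Point
  | .vertex v => .vertex (C.rV v)
  | .inner f t _ _ => (C.rE f).elim (.vertex (C.rV (Δ.src f))) fun e => Γ.pt e t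

theorem incl_pt (e : Γ.E) {t : ℝ≥0∞} (ht : t ≤ Γ.len e) :
    C.incl (Γ.pt e t) = Δ.pt (C.iE e) t := by
  rcases eq_or_eq_or_lt e ht with rfl | rfl | ⟨h0, h1⟩
  · rw [pt_zero, pt_zero, C.src_iE, incl]
  · rw [← C.len_iE e, pt_len, C.len_iE e, pt_len, C.tgt_iE, incl]
  · rw [pt_of_lt e h0 h1, incl]

theorem retr_pt (e : Γ.E) {t : ℝ≥0∞} (ht : t ≤ Γ.len e) :
    C.retr (Δ.pt (C.iE e) t) = Γ.pt e t := by
  rcases eq_or_eq_or_lt e ht with rfl | rfl | ⟨h0, h1⟩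
  · rw [pt_zero, pt_zero, C.src_iE, retr, C.rV_iV]
  · rw [pt_len, ← C.len_iE e, pt_len, C.tgt_iE, retr, C.rV_iV]
  · rw [pt_of_lt _ h0 (by rwa [C.len_iE]), retr, C.rE_iE, Option.elim_some]

theorem retr_pt_of_eq_none {f : Δ.E} (hf : C.rE f = none) {t : ℝ≥0∞} (ht : t ≤ Δ.len f) :
    C.retr (Δ.pt f t) = .vertex (C.rV (Δ.src f)) := by
  rcases eq_or_eq_or_lt f ht with rfl | rfl | ⟨h0, h1⟩
  · rw [pt_zero, retr]
  · rw [pt_len, retr, C.rV_tgt f hf]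
  · rw [pt_of_lt _ h0 h1, retr, hf, Option.elim_none]

theorem eq_or (f : Δ.E) : (∃ e, C.iE e = f) ∨
    ∃ v, C.incl (Point.vertex v) = Point.vertex (Δ.src f) ∧
      ∀ t ≤ Δ.len f, C.retr (Δ.pt f t) = Point.vertex v := by
  refine (C.rE_eq f).imp_right fun h => ⟨C.rV (Δ.src f), ?_, fun t => C.retr_pt_of_eq_none h⟩
  rw [incl, C.iV_rV_src f h]

theorem mem_range_incl (e : Γ.E) {t : ℝ≥0∞} (ht : t ≤ Δ.len (C.iE e)) :
    Δ.pt (C.iE e) t ∈ range C.incl :=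
  ⟨Γ.pt e t, C.incl_pt e (C.len_iE e ▸ ht)⟩

/-- The retraction that collapses the edges outside the subgraph. -/
def retraction : Retraction Γ Δ where
  incl := C.incl
  retr := C.retr
  continuous_incl := continuous_iff.2 fun e => by
    have : (fun t : Iic (Γ.len e) => C.incl (Γ.pt e t)) = fun t : Iic (Γ.len e) => Δ.pt (C.iE e) t :=
      funext fun t => C.incl_pt e t.2
    rw [this]
    exact (continuousOn_pt (C.iE e)).comp_continuous continuous_subtype_val
      fun t => (C.len_iE e).symm ▸ t.2
  continuous_retr := continuous_iff.2 fun f => by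
    rcases C.eq_or f with ⟨e, rfl⟩ | ⟨v, -, h⟩
    · have : (fun t : Iic (Δ.len (C.iE e)) => C.retr (Δ.pt (C.iE e) t)) =
          fun t : Iic (Δ.len (C.iE e)) => Γ.pt e t :=
        funext fun t => C.retr_pt e (C.len_iE e ▸ t.2)
      rw [this]
      exact (continuousOn_pt e).comp_continuous continuous_subtype_val fun t => C.len_iE e ▸ t.2
    · have : (fun t : Iic (Δ.len f) => C.retr (Δ.pt f t)) = fun _ => Point.vertex v :=
        funext fun t => h t t.2
      rw [this]
      exact continuous_const
  retr_incl x := by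
    obtain ⟨e, t, ht, rfl⟩ := exists_pt_eq x
    rw [C.incl_pt e ht, C.retr_pt e ht]
  isClosed_range := by
    have := Γ.finE
    have h : range C.incl = ⋃ e, Δ.closedEdge (C.iE e) := by
      ext y
      rw [mem_iUnion]
      constructor
      · rintro ⟨x, rfl⟩
        obtain ⟨e, t, ht, rfl⟩ := exists_pt_eq x
        exact ⟨e, t, (C.len_iE e).symm ▸ ht, (C.incl_pt e ht).symm⟩
      · rintro ⟨e, t, ht, rfl⟩
        exact ⟨Γ.pt e t, C.incl_pt e (C.len_iE e ▸ ht)⟩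
    rw [h]
    exact isClosed_iUnion_of_finite fun e => isClosed_closedEdge _
  pathDist_incl x y := by
    refine le_antisymm (pathDist_le_of_segDist_le (f := C.incl) (fun x y => ?_) x y) ?_
    · refine le_segDist ?_
      rintro e s hs t ht rfl rfl
      rw [C.incl_pt e hs, C.incl_pt e ht]
      exact segDist_pt_le _ ((C.len_iE e).symm ▸ hs) ((C.len_iE e).symm ▸ ht)
    · have hr : ∀ x, C.retr (C.incl x) = x := fun x => by
        obtain ⟨e, t, ht, rfl⟩ := exists_pt_eq x
        rw [C.incl_pt e ht, C.retr_pt e ht]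
      have := pathDist_le_of_segDist_le (f := C.retr) (fun x y => ?_) (C.incl x) (C.incl y)
      · rwa [hr, hr] at this
      · refine le_segDist ?_
        rintro f s hs t ht rfl rfl
        rcases C.eq_or f with ⟨e, rfl⟩ | ⟨v, -, h⟩
        · rw [C.retr_pt e (C.len_iE e ▸ hs), C.retr_pt e (C.len_iE e ▸ ht)]
          exact segDist_pt_le _ (C.len_iE e ▸ hs) (C.len_iE e ▸ ht)
        · rw [h s hs, h t ht, segDist_self]
          exact zero_le
  finite_image := by
    have := Γ.finV
    refine (Set.finite_range (Point.vertex (Γ := Γ))).subset ?_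
    rintro _ ⟨y, hy, rfl⟩
    obtain ⟨f, t, ht, rfl⟩ := exists_pt_eq y
    rcases C.eq_or f with ⟨e, rfl⟩ | ⟨v, -, h⟩
    · exact (hy ⟨Γ.pt e t, C.incl_pt e (C.len_iE e ▸ ht)⟩).elim
    · exact ⟨v, (h t ht).symm⟩
  isPreconnected_fiber x := by
    refine isPreconnected_of_forall (C.incl x) fun y hy => ?_
    obtain ⟨f, t, ht, rfl⟩ := exists_pt_eq y
    rcases C.eq_or f with ⟨e, rfl⟩ | ⟨v, hv, h⟩
    · refine ⟨{C.incl x}, ?_, rfl, ?_, isPreconnected_singleton⟩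
      · obtain ⟨e, t, ht, rfl⟩ := exists_pt_eq x
        simp only [singleton_subset_iff, mem_preimage, mem_singleton_iff]
        rw [C.incl_pt e ht, C.retr_pt e ht]
      · rw [mem_preimage, mem_singleton_iff, C.retr_pt e (C.len_iE e ▸ ht)] at hy
        rw [mem_singleton_iff, ← hy, C.incl_pt e (C.len_iE e ▸ ht)]
    · obtain rfl : Point.vertex v = x := (h t ht).symm.trans hy
      refine ⟨Δ.closedEdge f, ?_, hv ▸ src_mem_closedEdge f, pt_mem_closedEdge f ht,
        isPreconnected_closedEdge f⟩
      rintro _ ⟨s, hs, rfl⟩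
      exact h s hs

end Collapse

/-! ### Attaching loops and rays -/

section AttachLoops

variable {k : ℕ} (p : Fin k → Γ.V) (hp : ∀ i, ¬ Γ.IsInfinite (p i))
    (c : Fin k → ℝ≥0) (hc : ∀ i, 0 < c i)

/-- The edge with index `b` of the attached loop with index `i`. -/
def loopEdge (i : Fin k) (b : Bool) : (Γ.attachLoops p hp c hc).E := Sum.inr (i, b)

/-- The vertex of the attached loop with index `i` opposite to its base point. -/
def loopVertex (i : Fin k) : (Γ.attachLoops p hp c hc).V := Sum.inr i

/-- Collapsing the attached loops. -/
def attachLoopsCollapse : Collapse Γ (Γ.attachLoops p hp c hc) where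
  iV := Sum.inl
  iE := Sum.inl
  rV := Sum.elim id p
  rE := Sum.elim some fun _ => none
  len_iE _ := rfl
  src_iE _ := rfl
  tgt_iE _ := rfl
  rV_iV _ := rfl
  rE_iE _ := rfl
  rE_eq := by
    rintro (e | i)
    · exact Or.inl ⟨e, rfl⟩
    · exact Or.inr rfl
  iV_rV_src := by
    rintro (e | i) h
    · cases h
    · rfl
  rV_tgt := by
    rintro (e | i) h
    · cases h
    · rfl

/-- The base point of the attached loop with index `i`. -/
def loopBase (i : Fin k) : (Γ.attachLoops p hp c hc).Point :=
  (attachLoopsCollapse p hp c hc).incl (.vertex (p i))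

/-- The attached loop with index `i`. -/
def loop (i : Fin k) : Set (Γ.attachLoops p hp c hc).Point :=
  ⋃ b, (Γ.attachLoops p hp c hc).closedEdge (loopEdge p hp c hc i b)

variable {p hp c hc}

theorem loopEdge_inj {i j : Fin k} {b b' : Bool} :
    loopEdge p hp c hc i b = loopEdge p hp c hc j b' ↔ i = j ∧ b = b' :=
  Sum.inr_injective.eq_iff.trans Prod.ext_iff

theorem retr_of_mem_loop {i : Fin k} {y : (Γ.attachLoops p hp c hc).Point}
    (hy : y ∈ loop p hp c hc i) :
    (attachLoopsCollapse p hp c hc).retr y = Point.vertex (p i) := by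
  obtain ⟨b, t, ht, rfl⟩ := mem_iUnion.1 hy
  exact (attachLoopsCollapse p hp c hc).retr_pt_of_eq_none rfl ht

theorem loopBase_mem_loop (i : Fin k) : loopBase p hp c hc i ∈ loop p hp c hc i :=
  mem_iUnion.2 ⟨true, src_mem_closedEdge (loopEdge p hp c hc i true)⟩

theorem mem_range_or_mem_loop (y : (Γ.attachLoops p hp c hc).Point) :
    y ∈ range (attachLoopsCollapse p hp c hc).incl ∨ ∃ i, y ∈ loop p hp c hc i := by
  obtain ⟨e | ⟨i, b⟩, t, ht, rfl⟩ := exists_pt_eq y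
  · exact Or.inl ((attachLoopsCollapse p hp c hc).mem_range_incl e ht)
  · exact Or.inr ⟨i, mem_iUnion.2 ⟨b, t, ht, rfl⟩⟩

theorem isClosed_loop (i : Fin k) : IsClosed (loop p hp c hc i) :=
  isClosed_iUnion_of_finite fun _ => isClosed_closedEdge _

/-- A point of a loop that is neither the base point nor the opposite vertex is an inner point of
one of the two edges of the loop. -/
theorem exists_of_mem_loop {i : Fin k} {y : (Γ.attachLoops p hp c hc).Point}
    (hy : y ∈ loop p hp c hc i) (h : y ≠ loopBase p hp c hc i)
    (h' : y ≠ Point.vertex (loopVertex p hp c hc i)) :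
    ∃ b t, 0 < t ∧ t < (Γ.attachLoops p hp c hc).len (loopEdge p hp c hc i b) ∧
      y = (Γ.attachLoops p hp c hc).pt (loopEdge p hp c hc i b) t := by
  obtain ⟨b, t, ht, rfl⟩ := mem_iUnion.1 hy
  rw [mem_Iic] at ht
  rcases eq_or_eq_or_lt _ ht with rfl | rfl | ⟨h0, h1⟩
  · exact (h (pt_zero _)).elim
  · exact (h' (pt_len _)).elim
  · exact ⟨b, t, h0, h1, rfl⟩

/-- Removing two points of a loop disconnects. -/
theorem not_isPreconnected_of_mem_loop {i : Fin k} {x y : (Γ.attachLoops p hp c hc).Point}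
    (hx : x ∈ loop p hp c hc i) (hy : y ∈ loop p hp c hc i) (hxy : x ≠ y)
    (hx1 : x ≠ loopBase p hp c hc i) (hx2 : x ≠ Point.vertex (loopVertex p hp c hc i))
    (hy1 : y ≠ loopBase p hp c hc i) (hy2 : y ≠ Point.vertex (loopVertex p hp c hc i)) :
    ¬ IsPreconnected ({x, y}ᶜ : Set (Γ.attachLoops p hp c hc).Point) := by
  classical
  obtain ⟨b, s, hs0, hs1, rfl⟩ := exists_of_mem_loop hx hx1 hx2
  obtain ⟨b', t, ht0, ht1, rfl⟩ := exists_of_mem_loop hy hy1 hy2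
  by_cases hb : b = b'
  · subst hb
    rcases lt_trichotomy s t with h | rfl | h
    · exact not_isPreconnected_compl_pair _ hs0 h ht1
    · exact (hxy rfl).elim
    · rw [pair_comm]
      exact not_isPreconnected_compl_pair _ ht0 h hs1
  · have hne : loopEdge p hp c hc i b' ≠ loopEdge p hp c hc i b := by
      simp [loopEdge_inj, Ne.symm hb]
    -- The vertex opposite to the base point is cut off.
    refine not_isPreconnected_of_cut {loopEdge p hp c hc i b, loopEdge p hp c hc i b'}
      (fun e => if e = loopEdge p hp c hc i b then s else t) {loopVertex p hp c hc i} ?_ ?_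
      ⟨_, rfl⟩ ⟨(attachLoopsCollapse p hp c hc).iV (p i), Sum.inl_ne_inr⟩ ?_
    · rintro e (rfl | rfl)
      · simp [hs0, hs1]
      · simp [hne, ht0, ht1]
    · rintro (e | ⟨j, b''⟩) he
      · exact ⟨fun h => (Sum.inl_ne_inr h).elim, fun h => (Sum.inl_ne_inr h).elim⟩
      · refine ⟨fun h => (Sum.inl_ne_inr h).elim, fun h => (he ?_).elim⟩
        obtain rfl : j = i := Sum.inr_injective h
        have hb'' : b'' = b ∨ b'' = b' := by
          cases b <;> cases b' <;> cases b'' <;> simp_all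
        rcases hb'' with rfl | rfl
        · exact Or.inl rfl
        · exact Or.inr rfl
    · rw [image_pair]
      simp [hne]

/-- If `F` contains at most one point of a loop, and neither its base point nor the opposite
vertex, then the points of the loop outside `F` are connected to the base point in the complement
of `F`. -/
theorem exists_isPreconnected_of_mem_loop {i : Fin k} {F : Set (Γ.attachLoops p hp c hc).Point}
    (hF : (F ∩ loop p hp c hc i).Subsingleton) (h : loopBase p hp c hc i ∉ F)
    (h' : Point.vertex (loopVertex p hp c hc i) ∉ F) {y : (Γ.attachLoops p hp c hc).Point}
    (hy : y ∈ loop p hp c hc i) (hyF : y ∉ F) :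
    ∃ C ⊆ Fᶜ, loopBase p hp c hc i ∈ C ∧ y ∈ C ∧ IsPreconnected C := by
  have hfree : ∃ b, (Γ.attachLoops p hp c hc).closedEdge (loopEdge p hp c hc i b) ⊆ Fᶜ := by
    by_cases ht : (Γ.attachLoops p hp c hc).closedEdge (loopEdge p hp c hc i true) ⊆ Fᶜ
    · exact ⟨true, ht⟩
    refine ⟨false, fun z hz hzF => ht fun w hw hwF => ?_⟩
    obtain rfl := hF ⟨hzF, mem_iUnion.2 ⟨false, hz⟩⟩ ⟨hwF, mem_iUnion.2 ⟨true, hw⟩⟩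
    obtain ⟨b, t, ht0, ht1, rfl⟩ := exists_of_mem_loop (mem_iUnion.2 ⟨false, hz⟩)
      (fun h2 => h (h2 ▸ hzF)) (fun h2 => h' (h2 ▸ hzF))
    rw [pt_of_lt _ ht0 ht1, inner_mem_closedEdge_iff, loopEdge_inj] at hz hw
    exact Bool.false_ne_true (hz.2.trans hw.2.symm)
  obtain ⟨b, hb⟩ := hfree
  obtain ⟨b', hy⟩ := mem_iUnion.1 hy
  exact exists_isPreconnected_of_parallel
    (j := loopEdge p hp c hc i b') (k := loopEdge p hp c hc i b) rfl rfl hb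
    (hF.anti (inter_subset_inter_right _ (subset_iUnion_of_subset b' subset_rfl))) hy hyF

end AttachLoops

/-- Collapsing an attached ray. -/
def attachRayCollapse (p : Γ.V) (hp : ¬ Γ.IsInfinite p) : Collapse Γ (Γ.attachRay p hp) where
  iV := some
  iE := some
  rV v := Option.elim v p id
  rE := id
  len_iE _ := rfl
  src_iE _ := rfl
  tgt_iE _ := rfl
  rV_iV _ := rfl
  rE_iE _ := rfl
  rE_eq := by
    rintro (_ | e)
    · exact Or.inr rfl
    · exact Or.inl ⟨e, rfl⟩
  iV_rV_src := by
    rintro (_ | e) h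
    · rfl
    · cases h
  rV_tgt := by
    rintro (_ | e) h
    · rfl
    · cases h

/-- Only finitely many of the points outside the subgraph fail to be cut points, as is the case if
the attached pieces are trees. -/
def Retraction.AttachesTrees (R : Retraction Γ Δ) : Prop :=
  ∃ B : Set Δ.Point, B.Finite ∧ ∀ y ∉ range R.incl, y ∉ B → ¬ IsPreconnected ({y}ᶜ : Set Δ.Point)

theorem attachesTrees_attachRay (p : Γ.V) (hp : ¬ Γ.IsInfinite p) :
    (attachRayCollapse p hp).retraction.AttachesTrees := by
  let ray : (Γ.attachRay p hp).E := none
  let tip : (Γ.attachRay p hp).V := none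
  refine ⟨{Point.vertex tip}, finite_singleton _, fun y hy hB => ?_⟩
  obtain ⟨_ | e, t, ht, rfl⟩ := exists_pt_eq y
  · change (Γ.attachRay p hp).pt ray t ∉ _ at hy
    change (Γ.attachRay p hp).pt ray t ∉ _ at hB
    change ¬ IsPreconnected {(Γ.attachRay p hp).pt ray t}ᶜ
    rcases eq_or_eq_or_lt ray ht with rfl | rfl | ⟨h0, h1⟩
    · exact (hy ⟨.vertex p, (pt_zero ray).symm⟩).elim
    · exact (hB (pt_len ray)).elim
    · refine not_isPreconnected_of_cut {ray} (fun _ => t) {tip} ?_ ?_ ⟨_, rfl⟩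
        ⟨(attachRayCollapse p hp).iV p, Option.some_ne_none p⟩ ?_
      · rintro e rfl
        exact ⟨h0, h1⟩
      · rintro (_ | e) he
        · exact (he rfl).elim
        · exact ⟨fun h => (Option.some_ne_none _ h).elim, fun h => (Option.some_ne_none _ h).elim⟩
      · rw [image_singleton]
  · exact (hy ((attachRayCollapse p hp).mem_range_incl e ht)).elim

theorem MetricIso.attachesTrees (h : MetricIso Γ Δ) : h.retraction.AttachesTrees :=
  ⟨∅, finite_empty, fun y hy => (hy (h.toHomeo.surjective y)).elim⟩

theorem Retraction.AttachesTrees.trans {R : Retraction Γ Δ} {S : Retraction Δ Θ}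
    (hR : R.AttachesTrees) (hS : S.AttachesTrees) : (R.trans S).AttachesTrees := by
  obtain ⟨B, hB, hR⟩ := hR
  obtain ⟨C, hC, hS⟩ := hS
  refine ⟨S.incl '' (B ∪ S.base) ∪ C, ((hB.union S.finite_image).image _).union hC, ?_⟩
  intro y hy hyB
  by_cases h : y ∈ range S.incl
  · obtain ⟨z, rfl⟩ := h
    simp only [mem_union, S.incl_injective.mem_set_image, not_or] at hyB
    rw [← image_singleton, S.isPreconnected_compl_image_iff (disjoint_singleton_left.2 hyB.1.2)]
    refine hR z ?_ hyB.1.1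
    rintro ⟨x, rfl⟩
    exact hy ⟨x, rfl⟩
  · exact hS y h fun h' => hyB (Or.inr h')

/-- A graph is a retract of each of its tropical modifications, which attach trees. -/
theorem IsTropicalModification.exists_retraction (h : IsTropicalModification Γ Δ) :
    ∃ R : Retraction Γ Δ, R.AttachesTrees := by
  induction h with
  | refl =>
    let i : MetricIso Γ Γ := ⟨Homeomorph.refl _, fun _ _ => rfl⟩
    exact ⟨i.retraction, i.attachesTrees⟩
  | tail _ h ih =>
    obtain ⟨R, hR⟩ := ih
    obtain ⟨H, i, p, hp, ⟨j⟩⟩ := h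
    exact ⟨_, ((hR.trans i.symm.attachesTrees).trans (attachesTrees_attachRay p hp)).trans
      j.symm.attachesTrees⟩

/-! ### The theta graph -/

section Theta

variable (L : Fin 3 → ℝ≥0) (hL : ∀ i, 0 < L i)

/-- The edge `e_k` of the theta graph. -/
def thetaEdge (k : Fin 3) : (theta L hL).E := k

/-- The vertex `v_1` (`false`) or `v_2` (`true`) of the theta graph. -/
def thetaVertex (b : Bool) : (theta L hL).Point := .vertex b

/-- The closed edge `e_k` of the theta graph. -/
def thetaArc (k : Fin 3) : Set (theta L hL).Point := (theta L hL).closedEdge (thetaEdge L hL k)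

/-- The parametrization of the closed edge `e_k` of the theta graph by a real interval. -/
def thetaPath (k : Fin 3) (t : ℝ) : (theta L hL).Point :=
  (theta L hL).pt (thetaEdge L hL k) (ENNReal.ofReal t)

/-- The coordinate of the theta graph that increases from `0` to `1` along each edge. -/
def thetaCoord : (theta L hL).Point → ℝ
  | .vertex b => cond b 1 0
  | .inner e t _ _ => t.toReal / ((theta L hL).len e).toReal

variable {L hL}

theorem ofReal_le_len {k : Fin 3} {t : ℝ} (ht : t ≤ L k) :
    ENNReal.ofReal t ≤ (theta L hL).len (thetaEdge L hL k) :=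
  ENNReal.ofReal_le_of_le_toReal ht

theorem thetaPath_zero (k : Fin 3) : thetaPath L hL k 0 = thetaVertex L hL false := by
  unfold thetaPath
  rw [ENNReal.ofReal_zero, pt_zero]
  rfl

theorem thetaPath_len (k : Fin 3) : thetaPath L hL k (L k) = thetaVertex L hL true := by
  have h : ENNReal.ofReal (L k) = (theta L hL).len (thetaEdge L hL k) :=
    ENNReal.ofReal_coe_nnreal
  unfold thetaPath
  rw [h, pt_len]
  rfl

theorem thetaPath_mem (k : Fin 3) {t : ℝ} (ht : t ≤ L k) :
    thetaPath L hL k t ∈ thetaArc L hL k :=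
  pt_mem_closedEdge _ (ofReal_le_len ht)

theorem mem_thetaArc_iff {k : Fin 3} {x : (theta L hL).Point} :
    x ∈ thetaArc L hL k ↔ ∃ t ∈ Icc (0 : ℝ) (L k), thetaPath L hL k t = x := by
  constructor
  · rintro ⟨t, ht, rfl⟩
    have hfin : t ≠ ∞ := ne_top_of_le_ne_top ENNReal.coe_ne_top ht
    refine ⟨t.toReal, ⟨ENNReal.toReal_nonneg, ENNReal.toReal_mono ENNReal.coe_ne_top ht⟩, ?_⟩
    rw [thetaPath, ENNReal.ofReal_toReal hfin]
  · rintro ⟨t, ht, rfl⟩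
    exact thetaPath_mem k ht.2

theorem exists_mem_thetaArc (x : (theta L hL).Point) : ∃ k, x ∈ thetaArc L hL k := by
  obtain ⟨k, t, ht, rfl⟩ := exists_pt_eq x
  exact ⟨k, t, ht, rfl⟩

theorem thetaVertex_mem (b : Bool) (k : Fin 3) : thetaVertex L hL b ∈ thetaArc L hL k := by
  cases b
  · exact thetaPath_zero (hL := hL) k ▸ thetaPath_mem k (L k).2
  · exact thetaPath_len (hL := hL) k ▸ thetaPath_mem k le_rfl

theorem thetaVertex_ne : thetaVertex L hL false ≠ thetaVertex L hL true := by
  intro h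
  cases h

theorem exists_inner_of_mem_thetaArc {k : Fin 3} {x : (theta L hL).Point}
    (hx : x ∈ thetaArc L hL k) (hv : ∀ b, x ≠ thetaVertex L hL b) :
    ∃ t, 0 < t ∧ t < (theta L hL).len (thetaEdge L hL k) ∧
      x = (theta L hL).pt (thetaEdge L hL k) t := by
  obtain ⟨t, ht, rfl⟩ := hx
  rw [mem_Iic] at ht
  rcases eq_or_eq_or_lt _ ht with rfl | rfl | ⟨h0, h1⟩
  · exact (hv false (pt_zero _)).elim
  · exact (hv true (pt_len _)).elim
  · exact ⟨t, h0, h1, rfl⟩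

theorem eq_of_mem_thetaArc {j k : Fin 3} {x : (theta L hL).Point} (hj : x ∈ thetaArc L hL j)
    (hk : x ∈ thetaArc L hL k) (hv : ∀ b, x ≠ thetaVertex L hL b) : j = k := by
  obtain ⟨t, h0, h1, rfl⟩ := exists_inner_of_mem_thetaArc hj hv
  rw [pt_of_lt _ h0 h1] at hk
  exact ((inner_mem_closedEdge_iff h0 h1).1 hk).symm

theorem thetaCoord_pt (e : (theta L hL).E) {t : ℝ≥0∞} (ht : t ≤ (theta L hL).len e) :
    thetaCoord L hL ((theta L hL).pt e t) = t.toReal / ((theta L hL).len e).toReal := by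
  rcases eq_or_eq_or_lt e ht with rfl | rfl | ⟨h0, h1⟩
  · rw [pt_zero, ENNReal.toReal_zero, zero_div]
    rfl
  · rw [pt_len, div_self]
    · rfl
    · exact (ENNReal.toReal_pos ((theta L hL).len_pos e).ne' ENNReal.coe_ne_top).ne'
  · rw [pt_of_lt e h0 h1, thetaCoord]

theorem continuous_thetaCoord : Continuous (thetaCoord L hL) := by
  rw [continuous_iff]
  intro e
  have : (fun t : Iic ((theta L hL).len e) => thetaCoord L hL ((theta L hL).pt e t)) =
      fun t : Iic ((theta L hL).len e) => (t : ℝ≥0∞).toReal / ((theta L hL).len e).toReal :=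
    funext fun t => thetaCoord_pt e t.2
  rw [this]
  refine Continuous.div_const ?_ _
  exact ENNReal.continuousOn_toReal.comp_continuous continuous_subtype_val
    fun t => ne_top_of_le_ne_top ENNReal.coe_ne_top t.2

theorem thetaCoord_thetaPath (k : Fin 3) {t : ℝ} (ht : t ∈ Icc (0 : ℝ) (L k)) :
    thetaCoord L hL (thetaPath L hL k t) = t / L k := by
  rw [thetaPath, thetaCoord_pt _ (ofReal_le_len ht.2), ENNReal.toReal_ofReal ht.1]
  rfl

theorem continuousOn_thetaPath (k : Fin 3) :
    ContinuousOn (thetaPath L hL k) (Icc 0 (L k)) :=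
  (continuousOn_pt _).comp ENNReal.continuous_ofReal.continuousOn
    fun _ ht => ofReal_le_len ht.2

theorem thetaPath_inj {k : Fin 3} {s t : ℝ} (hs : s ∈ Icc (0 : ℝ) (L k))
    (ht : t ∈ Icc (0 : ℝ) (L k)) (h : thetaPath L hL k s = thetaPath L hL k t) : s = t := by
  have := congrArg (thetaCoord L hL) h
  rwa [thetaCoord_thetaPath k hs, thetaCoord_thetaPath k ht,
    div_left_inj' (by exact_mod_cast (hL k).ne')] at this

/-- The theta graph stays connected after the removal of at most one inner point of each of two
edges. -/
theorem isPreconnected_compl_theta {F : Set (theta L hL).Point}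
    (hF : ∀ k, (F ∩ thetaArc L hL k).Subsingleton) (hk : ∃ k, F ∩ thetaArc L hL k = ∅) :
    IsPreconnected Fᶜ := by
  obtain ⟨k, hk⟩ := hk
  have hkF : thetaArc L hL k ⊆ Fᶜ := fun x hx hxF =>
    (Set.ext_iff.1 hk x).1 ⟨hxF, hx⟩
  refine isPreconnected_of_forall (thetaVertex L hL false) fun y hy => ?_
  obtain ⟨j, hj⟩ := exists_mem_thetaArc y
  exact exists_isPreconnected_of_parallel (j := thetaEdge L hL j) (k := thetaEdge L hL k)
    rfl rfl hkF (hF j) hj hy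

theorem not_isPreconnected_of_mem_thetaArc {k : Fin 3} {x y : (theta L hL).Point}
    (hx : x ∈ thetaArc L hL k) (hy : y ∈ thetaArc L hL k) (hxy : x ≠ y)
    (hxv : ∀ b, x ≠ thetaVertex L hL b) (hyv : ∀ b, y ≠ thetaVertex L hL b) :
    ¬ IsPreconnected ({x, y}ᶜ : Set (theta L hL).Point) := by
  obtain ⟨s, hs0, hs1, rfl⟩ := exists_inner_of_mem_thetaArc hx hxv
  obtain ⟨t, ht0, ht1, rfl⟩ := exists_inner_of_mem_thetaArc hy hyv
  rcases lt_trichotomy s t with h | rfl | h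
  · exact not_isPreconnected_compl_pair _ hs0 h ht1
  · exact (hxy rfl).elim
  · rw [pair_comm]
    exact not_isPreconnected_compl_pair _ ht0 h hs1

/-- Removing one inner point of each edge disconnects the theta graph. -/
theorem not_isPreconnected_of_forall_mem_thetaArc {x : Fin 3 → (theta L hL).Point}
    (hx : ∀ k, x k ∈ thetaArc L hL k) (hv : ∀ k b, x k ≠ thetaVertex L hL b) :
    ¬ IsPreconnected (range x)ᶜ := by
  choose c h0 h1 hc using fun k => exists_inner_of_mem_thetaArc (hx k) (hv k)
  refine not_isPreconnected_of_cut (Γ := theta L hL) univ c {b | b = false}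
    (fun k _ => ⟨h0 k, h1 k⟩) (fun e he => (he trivial).elim) ⟨false, rfl⟩
    ⟨true, Bool.true_eq_false_eq_False⟩ ?_
  rw [image_univ]
  exact congrArg range (funext hc)

/-- Close to an inner point of an edge of the theta graph, the path metric is the metric of the
edge. -/
theorem pathDist_thetaPath {k : Fin 3} {a t : ℝ} (ha : a ∈ Ioo (0 : ℝ) (L k))
    (ht : t ∈ Icc (0 : ℝ) (L k)) (h : |t - a| ≤ min a (L k - a)) :
    (theta L hL).pathDist (thetaPath L hL k t) (thetaPath L hL k a) = ENNReal.ofReal |t - a| := by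
  have hdist : ∀ s u : ℝ, 0 ≤ s → 0 ≤ u →
      (ENNReal.ofReal s - ENNReal.ofReal u) + (ENNReal.ofReal u - ENNReal.ofReal s) =
        ENNReal.ofReal |s - u| := by
    intro s u hs hu
    rw [← ENNReal.ofReal_sub s hu, ← ENNReal.ofReal_sub u hs]
    rcases le_total s u with h | h
    · rw [ENNReal.ofReal_of_nonpos (sub_nonpos.2 h), zero_add, abs_of_nonpos (sub_nonpos.2 h),
        neg_sub]
    · rw [ENNReal.ofReal_of_nonpos (sub_nonpos.2 h), add_zero, abs_of_nonneg (sub_nonneg.2 h)]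
  refine le_antisymm ?_ ?_
  · refine (pathDist_le_segDist _ _).trans ?_
    refine (segDist_pt_le _ (ofReal_le_len ht.2) (ofReal_le_len ha.2.le)).trans_eq ?_
    exact hdist t a ht.1 ha.1.le
  · -- The truncated distance from the point with parameter `a` is `1`-Lipschitz.
    classical
    set r : ℝ≥0∞ := ENNReal.ofReal (min a (L k - a)) with hr
    set A : ℝ≥0∞ := ENNReal.ofReal a with hA
    let g : (theta L hL).Point → ℝ≥0∞
      | .vertex _ => r
      | .inner e s _ _ => if e = thetaEdge L hL k then min r ((s - A) + (A - s)) else r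
    have hg : ∀ e, ∀ s ≤ (theta L hL).len e, g ((theta L hL).pt e s) =
        if e = thetaEdge L hL k then min r ((s - A) + (A - s)) else r := by
      intro e s hs
      rcases eq_or_eq_or_lt e hs with rfl | rfl | ⟨h0, h1⟩
      · rw [pt_zero]
        split_ifs
        · refine (min_eq_left ?_).symm
          rw [zero_tsub, zero_add, tsub_zero]
          exact ENNReal.ofReal_le_ofReal (min_le_left _ _)
        · rfl
      · rw [pt_len]
        split_ifs with he
        · rw [he]
          refine (min_eq_left ?_).symm
          have : (theta L hL).len (thetaEdge L hL k) = ENNReal.ofReal (L k) :=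
            ENNReal.ofReal_coe_nnreal.symm
          rw [this, hA, ← ENNReal.ofReal_sub _ ha.1.le]
          exact le_add_right (ENNReal.ofReal_le_ofReal (min_le_right _ _))
        · rfl
      · rw [pt_of_lt e h0 h1]
    have hlip : ∀ x y, g x ≤ g y + (theta L hL).segDist x y := by
      intro x y
      rw [← tsub_le_iff_left]
      refine le_segDist ?_
      rintro e s hs u hu rfl rfl
      rw [tsub_le_iff_left, hg e s hs, hg e u hu]
      split_ifs
      · rcases le_total r ((u - A) + (A - u)) with h | h
        · rw [min_eq_left h]
          exact (min_le_left _ _).trans le_self_add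
        · rw [min_eq_right h]
          refine (min_le_right _ _).trans ?_
          refine (add_le_add (tsub_le_tsub_add_tsub (b := u))
            (tsub_le_tsub_add_tsub (b := u))).trans_eq ?_
          ring
      · exact le_self_add
    have := le_add_pathDist hlip (thetaPath L hL k t) (thetaPath L hL k a)
    rw [thetaPath, thetaPath, hg _ _ (ofReal_le_len ht.2), hg _ _ (ofReal_le_len ha.2.le),
      if_pos rfl, if_pos rfl, ← hA, tsub_self, add_zero, min_eq_right (zero_le (a := r)), zero_add, hA,
      hdist t a ht.1 ha.1.le, min_eq_right (ENNReal.ofReal_le_ofReal h)] at this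
    exact this

end Theta

/-! ### Topology of a graph made of three parallel arcs, loops and trees -/

/-- The topological properties of a theta graph with loops and trees attached that are used below:
the three arcs of the theta graph and the loops form the family `P` of parts, and `B` is a finite
set of exceptional points. -/
structure IsLoopedTheta {X I : Type*} [TopologicalSpace X] (P : Fin 3 ⊕ I → Set X) (B : Set X) :
    Prop where
  finite : B.Finite
  isClosed : ∀ p, IsClosed (P p)
  nonempty : ∀ p, (P p).Nonempty
  subset_of_diff : ∀ p, ∀ B' : Set X, B'.Finite → ∀ Z, IsClosed Z → P p \ B' ⊆ Z → P p ⊆ Z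
  exists_mem : ∀ x ∉ B, IsPreconnected ({x}ᶜ : Set X) → ∃ p, x ∈ P p
  eq_of_mem : ∀ x ∉ B, ∀ p q, x ∈ P p → x ∈ P q → p = q
  not_isPreconnected_pair : ∀ x ∉ B, ∀ y ∉ B, x ≠ y → ∀ p, x ∈ P p → y ∈ P p →
    ¬ IsPreconnected ({x, y}ᶜ : Set X)
  not_isPreconnected_triple : ∀ x : Fin 3 → X, (∀ k, x k ∉ B) → (∀ k, x k ∈ P (Sum.inl k)) →
    ¬ IsPreconnected (range x)ᶜ
  isPreconnected : ∀ F : Set X, Disjoint F B → F ⊆ ⋃ p, P p → (∀ p, (F ∩ P p).Subsingleton) →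
    (∃ k, F ∩ P (Sum.inl k) = ∅) → IsPreconnected Fᶜ

namespace IsLoopedTheta

variable {X I : Type*} [TopologicalSpace X] {P : Fin 3 ⊕ I → Set X} {B : Set X}

theorem exists_generic (h : IsLoopedTheta P B) (p : Fin 3 ⊕ I) {B' : Set X} (hB' : B'.Finite) :
    ∃ x ∈ P p, x ∉ B' := by
  by_contra! hne
  obtain ⟨x, hx⟩ := h.nonempty p
  exact h.subset_of_diff p B' hB' ∅ isClosed_empty (fun y hy => hy.2 (hne y hy.1)) hx

/-- Points on different parts do not disconnect, if these parts do not include all three arcs. -/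
theorem isPreconnected_range (h : IsLoopedTheta P B) {J : Type*} {x : J → X} {p : J → Fin 3 ⊕ I}
    (hxB : ∀ j, x j ∉ B) (hx : ∀ j, x j ∈ P (p j)) (hp : ∀ i j, p i = p j → x i = x j)
    (hk : ∃ k, ∀ j, p j ≠ Sum.inl k) : IsPreconnected (range x)ᶜ := by
  refine h.isPreconnected _ ?_ ?_ ?_ ?_
  · rw [disjoint_left]
    rintro _ ⟨j, rfl⟩
    exact hxB j
  · rintro _ ⟨j, rfl⟩
    exact mem_iUnion.2 ⟨_, hx j⟩
  · rintro q _ ⟨⟨i, rfl⟩, hi⟩ _ ⟨⟨j, rfl⟩, hj⟩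
    exact hp i j ((h.eq_of_mem _ (hxB i) _ _ (hx i) hi).trans
      (h.eq_of_mem _ (hxB j) _ _ hj (hx j)))
  · obtain ⟨k, hk⟩ := hk
    refine ⟨k, eq_empty_of_forall_notMem ?_⟩
    rintro _ ⟨⟨j, rfl⟩, hj⟩
    exact hk j (h.eq_of_mem _ (hxB j) _ _ (hx j) hj)

theorem isPreconnected_compl_singleton (h : IsLoopedTheta P B) {x : X} (hx : x ∉ B)
    {p : Fin 3 ⊕ I} (hp : x ∈ P p) : IsPreconnected ({x}ᶜ : Set X) := by
  have := h.isPreconnected_range (x := fun _ : Unit => x) (p := fun _ => p) (fun _ => hx)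
    (fun _ => hp) (fun _ _ _ => rfl) (by
      rcases p with k | i
      · obtain ⟨j, hj⟩ := exists_ne k
        exact ⟨j, fun _ h => hj (Sum.inl_injective h).symm⟩
      · exact ⟨0, fun _ => Sum.inr_ne_inl⟩)
  rwa [range_const] at this

theorem isPreconnected_compl_pair (h : IsLoopedTheta P B) {x y : X} (hx : x ∉ B) (hy : y ∉ B)
    {p q : Fin 3 ⊕ I} (hp : x ∈ P p) (hq : y ∈ P q) (hpq : p ≠ q) :
    IsPreconnected ({x, y}ᶜ : Set X) := by
  have hFin : ∀ a b : Fin 3, ∃ k, a ≠ k ∧ b ≠ k := by decide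
  have := h.isPreconnected_range (x := fun b : Bool => cond b x y) (p := fun b => cond b p q)
    (by rintro (_ | _) <;> assumption) (by rintro (_ | _) <;> assumption)
    (by
      rintro (_ | _) (_ | _) h
      · rfl
      · exact (hpq h.symm).elim
      · exact (hpq h).elim
      · rfl) (by
      rcases p with a | a <;> rcases q with b | b
      · obtain ⟨k, h1, h2⟩ := hFin a b
        exact ⟨k, by rintro (_ | _) <;> simp [h1, h2]⟩
      · obtain ⟨k, h1, -⟩ := hFin a a
        exact ⟨k, by rintro (_ | _) <;> simp [h1]⟩
      · obtain ⟨k, h1, -⟩ := hFin b b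
        exact ⟨k, by rintro (_ | _) <;> simp [h1]⟩
      · exact ⟨0, by rintro (_ | _) <;> simp⟩)
  have hr : range (fun b : Bool => cond b x y) = {x, y} := by
    ext z
    simp [eq_comm, or_comm]
  rwa [hr] at this

theorem _root_.Homeomorph.isPreconnected_compl_image_iff {Y : Type*} [TopologicalSpace Y]
    (ι : X ≃ₜ Y) {F : Set X} : IsPreconnected (ι '' F)ᶜ ↔ IsPreconnected Fᶜ := by
  rw [← image_compl_eq ι.bijective, ι.isPreconnected_image]

/-- A homeomorphism maps arcs to arcs and loops to loops: two generic points that do not disconnect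
by themselves are on the same part exactly if they disconnect together, and only the three arcs
contain three points that disconnect together but not in pairs. -/
theorem exists_map_parts (h : IsLoopedTheta P B) (ι : X ≃ₜ X) :
    ∃ (τ : Fin 3 → Fin 3) (ρ : I → I), (∀ k, MapsTo ι (P (Sum.inl k)) (P (Sum.inl (τ k)))) ∧
      ∀ i, MapsTo ι (P (Sum.inr i)) (P (Sum.inr (ρ i))) := by
  have hfin : (B ∪ ι ⁻¹' B).Finite := h.finite.union (h.finite.preimage ι.injective.injOn)
  set B' := B ∪ ι ⁻¹' B with hB'
  have hB1 : ∀ {x}, x ∉ B' → x ∉ B := fun hx h => hx (Or.inl h)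
  have hB2 : ∀ {x}, x ∉ B' → ι x ∉ B := fun hx h => hx (Or.inr h)
  have hpart : ∀ p, ∀ x ∈ P p, x ∉ B' → ∃ q, ι x ∈ P q := by
    intro p x hx hxB
    refine h.exists_mem _ (hB2 hxB) ?_
    rw [← image_singleton, ι.isPreconnected_compl_image_iff]
    exact h.isPreconnected_compl_singleton (hB1 hxB) hx
  choose g hg hgB using fun p => h.exists_generic p hfin
  choose π hπ using fun p => hpart p (g p) (hg p) (hgB p)
  have hsame : ∀ p, ∀ x ∈ P p, x ∉ B' → ι x ∈ P (π p) := by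
    intro p x hx hxB
    obtain ⟨q, hq⟩ := hpart p x hx hxB
    by_cases hxg : x = g p
    · exact hxg ▸ hπ p
    by_cases hqp : q = π p
    · exact hqp ▸ hq
    refine (h.not_isPreconnected_pair x (hB1 hxB) (g p) (hB1 (hgB p)) hxg p hx (hg p) ?_).elim
    rw [← ι.isPreconnected_compl_image_iff, image_pair]
    exact h.isPreconnected_compl_pair (hB2 hxB) (hB2 (hgB p)) hq (hπ p) hqp
  have hmaps : ∀ p, MapsTo ι (P p) (P (π p)) := fun p =>
    h.subset_of_diff p B' hfin (ι ⁻¹' P (π p)) ((h.isClosed _).preimage ι.continuous)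
      fun x hx => hsame p x hx.1 hx.2
  have hinj : Function.Injective π := by
    intro p q hpq
    by_contra hne
    have hgne : g p ≠ g q := fun he =>
      hne (h.eq_of_mem _ (hB1 (hgB p)) _ _ (hg p) (he ▸ hg q))
    refine h.not_isPreconnected_pair _ (hB2 (hgB p)) _ (hB2 (hgB q)) (ι.injective.ne hgne) _
      (hπ p) (hpq ▸ hπ q) ?_
    rw [← image_pair, ι.isPreconnected_compl_image_iff]
    exact h.isPreconnected_compl_pair (hB1 (hgB p)) (hB1 (hgB q)) (hg p) (hg q) hne
  have harc : ∀ j : Fin 3, ∃ k, π (Sum.inl j) = Sum.inl k := by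
    have hall : ∀ k, ∃ j : Fin 3, π (Sum.inl j) = Sum.inl k := by
      by_contra! hk
      refine h.not_isPreconnected_triple (fun j => g (Sum.inl j)) (fun j => hB1 (hgB _))
        (fun j => hg _) ?_
      rw [← ι.isPreconnected_compl_image_iff, ← range_comp]
      exact h.isPreconnected_range (p := fun j => π (Sum.inl j)) (fun j => hB2 (hgB _))
        (fun j => hπ _) (fun i j hij => by rw [Sum.inl_injective (hinj hij)]) hk
    choose f hf using hall
    have hfinj : Function.Injective f := fun a b hab =>
      Sum.inl_injective ((hf a).symm.trans ((congrArg (fun j => π (Sum.inl j)) hab).trans (hf b)))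
    intro j
    obtain ⟨k, rfl⟩ := (Finite.injective_iff_surjective.1 hfinj) j
    exact ⟨k, hf k⟩
  choose τ hτ using harc
  have hτinj : Function.Injective τ := fun a b hab =>
    Sum.inl_injective (hinj ((hτ a).trans ((congrArg Sum.inl hab).trans (hτ b).symm)))
  have hloop : ∀ i : I, ∃ j, π (Sum.inr i) = Sum.inr j := by
    intro i
    rcases hk : π (Sum.inr i) with k | j
    · obtain ⟨a, rfl⟩ := (Finite.injective_iff_surjective.1 hτinj) k
      exact (Sum.inl_ne_inr (hinj ((hτ a).trans hk.symm))).elim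
    · exact ⟨j, rfl⟩
  choose ρ hρ using hloop
  exact ⟨τ, ρ, fun k => hτ k ▸ hmaps _, fun i => hρ i ▸ hmaps _⟩

end IsLoopedTheta

/-! ### Isometries of the theta graph -/

/-- A locally isometric increasing bijection of real intervals is a translation. -/
theorem eq_self_of_strictMonoOn {a b : ℝ} (ha : 0 < a) {σ : ℝ → ℝ}
    (hmono : StrictMonoOn σ (Icc 0 a)) (hc : ContinuousOn σ (Icc 0 a))
    (hm : MapsTo σ (Icc 0 a) (Icc 0 b)) (hs : SurjOn σ (Icc 0 a) (Icc 0 b))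
    (hloc : ∀ t ∈ Ioo 0 a, σ t ∈ Ioo 0 b → ∀ᶠ s in 𝓝 t, |σ s - σ t| = |s - t|) :
    a = b ∧ ∀ t ∈ Icc 0 a, σ t = t := by
  have h0 : (0 : ℝ) ∈ Icc 0 a := ⟨le_rfl, ha.le⟩
  have h1 : a ∈ Icc 0 a := ⟨ha.le, le_rfl⟩
  have hb : 0 ≤ b := (hm h0).1.trans (hm h0).2
  have hσ0 : σ 0 = 0 := by
    obtain ⟨s, hs1, hs2⟩ := hs (⟨le_rfl, hb⟩ : (0 : ℝ) ∈ Icc 0 b)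
    exact le_antisymm (hs2 ▸ hmono.monotoneOn h0 hs1 hs1.1) (hm h0).1
  have hσ1 : σ a = b := by
    obtain ⟨s, hs1, hs2⟩ := hs (⟨hb, le_rfl⟩ : b ∈ Icc 0 b)
    exact le_antisymm (hm h1).2 (hs2 ▸ hmono.monotoneOn hs1 h1 hs1.2)
  have hderiv : ∀ t ∈ Ioo 0 a, HasDerivAt σ 1 t := by
    intro t ht
    have ht' := Ioo_subset_Icc_self ht
    have hint : σ t ∈ Ioo 0 b :=
      ⟨hσ0 ▸ hmono h0 ht' ht.1, hσ1 ▸ hmono ht' h1 ht.2⟩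
    refine ((hasDerivAt_id t).add_const (σ t - t)).congr_of_eventuallyEq ?_
    filter_upwards [hloc t ht hint, Ioo_mem_nhds ht.1 ht.2] with s hs hs'
    have hs' := Ioo_subset_Icc_self hs'
    rw [id]
    rcases le_total t s with h | h
    · rw [abs_of_nonneg (sub_nonneg.2 (hmono.monotoneOn ht' hs' h)),
        abs_of_nonneg (sub_nonneg.2 h)] at hs
      linarith
    · rw [abs_of_nonpos (sub_nonpos.2 (hmono.monotoneOn hs' ht' h)),
        abs_of_nonpos (sub_nonpos.2 h)] at hs
      linarith
  have hid : ∀ t ∈ Icc 0 a, σ t = t := by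
    intro t ht
    rcases ht.1.eq_or_lt with rfl | h
    · exact hσ0
    obtain ⟨u, -, hu⟩ := exists_hasDerivAt_eq_slope σ (fun _ => 1) h
      (hc.mono (Icc_subset_Icc_right ht.2)) fun u hu => hderiv u ⟨hu.1, hu.2.trans_le ht.2⟩
    rw [hσ0, sub_zero, sub_zero, eq_div_iff h.ne', one_mul] at hu
    exact hu.symm
  exact ⟨(hid a h1).symm.trans hσ1, hid⟩

/-- A locally isometric bijection between real intervals is the identity or the reflection. -/
theorem eq_self_or_eq_sub {a b : ℝ} (ha : 0 < a) {σ : ℝ → ℝ} (hc : ContinuousOn σ (Icc 0 a))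
    (hm : MapsTo σ (Icc 0 a) (Icc 0 b)) (hi : InjOn σ (Icc 0 a))
    (hs : SurjOn σ (Icc 0 a) (Icc 0 b))
    (hloc : ∀ t ∈ Ioo 0 a, σ t ∈ Ioo 0 b → ∀ᶠ s in 𝓝 t, |σ s - σ t| = |s - t|) :
    a = b ∧ ((∀ t ∈ Icc 0 a, σ t = t) ∨ ∀ t ∈ Icc 0 a, σ t = a - t) := by
  rcases hc.strictMonoOn_of_injOn_Icc' ha.le hi with h | h
  · obtain ⟨hab, h⟩ := eq_self_of_strictMonoOn ha h hc hm hs hloc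
    exact ⟨hab, Or.inl h⟩
  · obtain ⟨hab, h⟩ := eq_self_of_strictMonoOn (σ := fun t => b - σ t) ha
      (fun s hs t ht hst => sub_lt_sub_left (h hs ht hst) b) (continuousOn_const.sub hc)
      (fun t ht => ⟨sub_nonneg.2 (hm ht).2, sub_le_self b (hm ht).1⟩)
      (fun t ht => by
        obtain ⟨s, hs, hst⟩ := hs (⟨sub_nonneg.2 ht.2, sub_le_self b ht.1⟩ : b - t ∈ Icc 0 b)
        exact ⟨s, hs, by simp [hst]⟩)
      (fun t ht hσ => by
        filter_upwards [hloc t ht ⟨by linarith [hσ.2], by linarith [hσ.1]⟩] with s hs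
        rw [← hs, sub_sub_sub_cancel_left, abs_sub_comm])
    exact ⟨hab, Or.inr fun t ht => by linarith [h t ht]⟩

section Theta

variable {L : Fin 3 → ℝ≥0} {hL : ∀ i, 0 < L i}

theorem thetaPath_ne_thetaVertex {k : Fin 3} {t : ℝ} (ht : t ∈ Ioo (0 : ℝ) (L k)) (b : Bool) :
    thetaPath L hL k t ≠ thetaVertex L hL b := by
  have ht' := Ioo_subset_Icc_self ht
  cases b
  · rw [← thetaPath_zero k]
    exact fun h => ht.1.ne' (thetaPath_inj ht' ⟨le_rfl, (L k).2⟩ h)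
  · rw [← thetaPath_len k]
    exact fun h => ht.2.ne (thetaPath_inj ht' ⟨(L k).2, le_rfl⟩ h)

/-- An isometric involution of a theta graph with edges of different lengths that maps edges to
edges is the identity or reflects each edge at its midpoint. -/
theorem theta_involution (hL' : Function.Injective L) {f : (theta L hL).Point → (theta L hL).Point}
    (hf : Continuous f) (hff : ∀ x, f (f x) = x)
    (hd : ∀ x y, (theta L hL).pathDist (f x) (f y) = (theta L hL).pathDist x y)
    {τ : Fin 3 → Fin 3} (hτ : ∀ k, MapsTo f (thetaArc L hL k) (thetaArc L hL (τ k))) :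
    (∀ x, f x = x) ∨
      ∀ k, ∀ t ∈ Icc (0 : ℝ) (L k), f (thetaPath L hL k t) = thetaPath L hL k (L k - t) := by
  have hpos : ∀ k, (0 : ℝ) < L k := fun k => by exact_mod_cast hL k
  have hττ : ∀ k, τ (τ k) = k := by
    intro k
    have hmid : (L k : ℝ) / 2 ∈ Ioo (0 : ℝ) (L k) := ⟨half_pos (hpos k), half_lt_self (hpos k)⟩
    have hmem := thetaPath_mem (hL := hL) k hmid.2.le
    exact eq_of_mem_thetaArc (hff (thetaPath L hL k (L k / 2)) ▸ hτ _ (hτ _ hmem)) hmem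
      (thetaPath_ne_thetaVertex hmid)
  -- The map in terms of the parametrizations of the edges.
  have key : ∀ k, τ k = k ∧ ((∀ t ∈ Icc (0 : ℝ) (L k), f (thetaPath L hL k t) =
      thetaPath L hL k t) ∨ ∀ t ∈ Icc (0 : ℝ) (L k), f (thetaPath L hL k t) =
        thetaPath L hL k (L k - t)) := by
    intro k
    let σ : ℝ → ℝ := fun t => L (τ k) * thetaCoord L hL (f (thetaPath L hL k t))
    have hσ : ∀ t ∈ Icc (0 : ℝ) (L k), σ t ∈ Icc (0 : ℝ) (L (τ k)) ∧
        f (thetaPath L hL k t) = thetaPath L hL (τ k) (σ t) := by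
      intro t ht
      obtain ⟨s, hs, h⟩ := mem_thetaArc_iff.1 (hτ k (thetaPath_mem k ht.2))
      have : σ t = s := by
        change (L (τ k) : ℝ) * thetaCoord L hL (f (thetaPath L hL k t)) = s
        rw [← h, thetaCoord_thetaPath _ hs, mul_div_cancel₀ _ (hpos _).ne']
      rw [this]
      exact ⟨hs, h.symm⟩
    have hc : ContinuousOn σ (Icc 0 (L k)) :=
      continuousOn_const.mul
        ((continuous_thetaCoord.comp hf).comp_continuousOn (continuousOn_thetaPath k))
    obtain ⟨hlen, h⟩ := eq_self_or_eq_sub (hpos k) hc (fun t ht => (hσ t ht).1)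
      (by
        intro s hs t ht hst
        have : f (thetaPath L hL k s) = f (thetaPath L hL k t) := by
          rw [(hσ s hs).2, (hσ t ht).2, hst]
        refine thetaPath_inj (hL := hL) hs ht ?_
        rw [← hff (thetaPath L hL k s), this, hff])
      (by
        intro t ht
        have := hτ _ (thetaPath_mem (hL := hL) _ ht.2)
        rw [hττ] at this
        obtain ⟨s, hs, h⟩ := mem_thetaArc_iff.1 this
        refine ⟨s, hs, thetaPath_inj (hL := hL) (hσ s hs).1 ht ?_⟩
        rw [← (hσ s hs).2, h, hff])
      (by
        intro t ht hσt
        have hcont : ContinuousAt σ t := hc.continuousAt (Icc_mem_nhds ht.1 ht.2)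
        have hnear : ∀ᶠ s in 𝓝 t, |σ s - σ t| < min (σ t) (L (τ k) - σ t) := by
          have := Metric.tendsto_nhds.1 hcont (min (σ t) (L (τ k) - σ t))
            (lt_min hσt.1 (sub_pos.2 hσt.2))
          simpa [Real.dist_eq] using this
        have hnear' : ∀ᶠ s in 𝓝 t, |s - t| < min t (L k - t) := by
          have := Metric.tendsto_nhds.1 (continuousAt_id (x := t)) (min t (L k - t))
            (lt_min ht.1 (sub_pos.2 ht.2))
          simpa [Real.dist_eq] using this
        filter_upwards [hnear, hnear', Icc_mem_nhds ht.1 ht.2] with s h1 h2 h3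
        have e1 := pathDist_thetaPath (hL := hL) hσt (hσ s h3).1 h1.le
        have e2 := pathDist_thetaPath (hL := hL) ht h3 h2.le
        rw [← (hσ s h3).2, ← (hσ t (Ioo_subset_Icc_self ht)).2, hd, e2] at e1
        exact ((ENNReal.ofReal_eq_ofReal_iff (abs_nonneg _) (abs_nonneg _)).1 e1).symm)
    have hk : τ k = k := (hL' (NNReal.coe_injective hlen)).symm
    refine ⟨hk, h.imp (fun h t ht => ?_) fun h t ht => ?_⟩
    · rw [(hσ t ht).2, h t ht, hk]
    · rw [(hσ t ht).2, h t ht, hk]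
  -- The image of one vertex tells which of the two possibilities occurs on all edges.
  by_cases hv : f (thetaVertex L hL false) = thetaVertex L hL false
  · left
    intro x
    obtain ⟨k, hx⟩ := exists_mem_thetaArc x
    obtain ⟨t, ht, rfl⟩ := mem_thetaArc_iff.1 hx
    rcases (key k).2 with h | h
    · exact h t ht
    · have := h 0 ⟨le_rfl, (L k).2⟩
      rw [sub_zero, thetaPath_zero, thetaPath_len, hv] at this
      exact (thetaVertex_ne this).elim
  · right
    intro k
    rcases (key k).2 with h | h
    · have := h 0 ⟨le_rfl, (L k).2⟩
      rw [thetaPath_zero] at this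
      exact (hv this).elim
    · exact h

end Theta

/-! ### Theta graphs with loops and trees attached -/

/-- If the trace of `F` on `Γ` does not disconnect `Γ`, and `F` contains at most one point of each
attached loop, then `F` does not disconnect the graph with the loops. -/
theorem isPreconnected_compl_attachLoops {Γ : WeightedGraph} {k : ℕ} {p : Fin k → Γ.V}
    {hp : ∀ i, ¬ Γ.IsInfinite (p i)} {c : Fin k → ℝ≥0} {hc : ∀ i, 0 < c i}
    {F : Set (Γ.attachLoops p hp c hc).Point} (hF : ∀ i, (F ∩ loop p hp c hc i).Subsingleton)
    (hb : ∀ i, loopBase p hp c hc i ∉ F) (hv : ∀ i, Point.vertex (loopVertex p hp c hc i) ∉ F)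
    (h : IsPreconnected ((attachLoopsCollapse p hp c hc).incl ⁻¹' F)ᶜ) : IsPreconnected Fᶜ := by
  set A := (attachLoopsCollapse p hp c hc).incl '' ((attachLoopsCollapse p hp c hc).incl ⁻¹' F)ᶜ
    with hA
  have hApre : IsPreconnected A :=
    h.image _ (attachLoopsCollapse p hp c hc).retraction.continuous_incl.continuousOn
  have hAF : A ⊆ Fᶜ := by
    rintro _ ⟨x, hx, rfl⟩
    exact hx
  have hy : ∀ y ∈ Fᶜ, ∃ C ⊆ Fᶜ, y ∈ C ∧ IsPreconnected C ∧ (C ∩ A).Nonempty := by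
    intro y hy
    rcases mem_range_or_mem_loop y with ⟨x, rfl⟩ | ⟨i, hi⟩
    · have hmem : (attachLoopsCollapse p hp c hc).incl x ∈ A := ⟨x, hy, rfl⟩
      exact ⟨A, hAF, hmem, hApre, _, hmem, hmem⟩
    · obtain ⟨C, hC, h1, h2, h3⟩ := exists_isPreconnected_of_mem_loop (hF i) (hb i) (hv i) hi hy
      exact ⟨C, hC, h2, h3, _, h1, _, hb i, rfl⟩
  refine isPreconnected_of_forall_pair fun x hx y hy' => ?_
  obtain ⟨C, hC, hxC, hCpre, hCA⟩ := hy x hx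
  obtain ⟨D, hD, hyD, hDpre, hDA⟩ := hy y hy'
  refine ⟨C ∪ A ∪ D, union_subset (union_subset hC hAF) hD, Or.inl (Or.inl hxC), Or.inr hyD, ?_⟩
  refine (hCpre.union' hCA hApre).union' ?_ hDpre
  obtain ⟨z, hz1, hz2⟩ := hDA
  exact ⟨z, Or.inr hz2, hz1⟩

section Looped

variable {L : Fin 3 → ℝ≥0} {hL : ∀ i, 0 < L i} {H X : WeightedGraph}
  (h : MetricIso H (theta L hL)) {n : ℕ} {p : Fin n → H.V} {hp : ∀ i, ¬ H.IsInfinite (p i)}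
  {c : Fin n → ℝ≥0} {hc : ∀ i, 0 < c i} (S : Retraction (H.attachLoops p hp c hc) X)

/-- The retraction onto the theta graph that collapses the loops and the trees. -/
def thetaRetraction : Retraction (theta L hL) X :=
  (h.symm.retraction.trans (attachLoopsCollapse p hp c hc).retraction).trans S

/-- The closed edges of the theta graph and the attached loops. -/
def thetaPart : Fin 3 ⊕ Fin n → Set X.Point :=
  Sum.elim (fun k => (thetaRetraction h S).incl '' thetaArc L hL k)
    (fun i => S.incl '' loop p hp c hc i)

theorem thetaRetraction_incl (x : (theta L hL).Point) : (thetaRetraction h S).incl x =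
    S.incl ((attachLoopsCollapse p hp c hc).incl (h.toHomeo.symm x)) := rfl

theorem incl_loopBase (i : Fin n) : S.incl (loopBase p hp c hc i) =
    (thetaRetraction h S).incl (h.toHomeo (.vertex (p i))) := by
  rw [thetaRetraction_incl, Homeomorph.symm_apply_apply]
  rfl

theorem incl_mem_thetaPart (i : Fin n) :
    (thetaRetraction h S).incl (h.toHomeo (.vertex (p i))) ∈ thetaPart h S (Sum.inr i) :=
  ⟨_, loopBase_mem_loop i, incl_loopBase h S i⟩

theorem retr_of_mem_thetaPart {i : Fin n} {x : X.Point} (hx : x ∈ thetaPart h S (Sum.inr i)) :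
    (thetaRetraction h S).retr x = h.toHomeo (.vertex (p i)) := by
  obtain ⟨y, hy, rfl⟩ := hx
  change h.toHomeo ((attachLoopsCollapse p hp c hc).retr (S.retr (S.incl y))) = _
  rw [S.retr_incl, retr_of_mem_loop hy]

theorem exists_isLoopedTheta (hS : S.AttachesTrees)
    (hinj : Function.Injective fun i => h.toHomeo (.vertex (p i))) :
    ∃ B, IsLoopedTheta (thetaPart h S) B := by
  obtain ⟨B₀, hB₀, hcut⟩ := hS
  set R := thetaRetraction h S with hR
  set q : Fin n → (theta L hL).Point := fun i => h.toHomeo (.vertex (p i)) with hq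
  set B₁ : Set (theta L hL).Point := R.base ∪ range (thetaVertex L hL) ∪ range q with hB₁
  set B₂ : Set (H.attachLoops p hp c hc).Point :=
    S.base ∪ range fun i => Point.vertex (loopVertex p hp c hc i) with hB₂
  set B : Set X.Point := R.incl '' B₁ ∪ S.incl '' B₂ ∪ B₀ with hB
  have hfin : B.Finite := by
    have h1 : R.base.Finite := R.finite_image
    have h2 : S.base.Finite := S.finite_image
    exact ((((h1.union (finite_range _)).union (finite_range _)).image _).union
      ((h2.union (finite_range _)).image _)).union hB₀
  have hB1 : ∀ {x}, R.incl x ∉ B → x ∉ B₁ := fun hx hx1 => hx (Or.inl (Or.inl ⟨_, hx1, rfl⟩))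
  have hB2 : ∀ {x}, S.incl x ∉ B → x ∉ B₂ := fun hx hx1 => hx (Or.inl (Or.inr ⟨_, hx1, rfl⟩))
  have hbase : ∀ {x}, R.incl x ∉ B → x ∉ R.base := fun hx hx1 => hB1 hx (Or.inl (Or.inl hx1))
  have hvert : ∀ {x}, R.incl x ∉ B → ∀ b, x ≠ thetaVertex L hL b := fun hx b hx1 =>
    hB1 hx (Or.inl (Or.inr ⟨b, hx1.symm⟩))
  have hqB : ∀ i, R.incl (q i) ∈ B := fun i => Or.inl (Or.inl ⟨_, Or.inr ⟨i, rfl⟩, rfl⟩)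
  have hloopB : ∀ i, S.incl (loopBase p hp c hc i) ∈ B := fun i =>
    (incl_loopBase h S i).symm ▸ hqB i
  have hvertB : ∀ i, S.incl (Point.vertex (loopVertex p hp c hc i)) ∈ B := fun i =>
    Or.inl (Or.inr ⟨_, Or.inr ⟨i, rfl⟩, rfl⟩)
  have hne : ∀ {x y : (H.attachLoops p hp c hc).Point}, S.incl x ∉ B → S.incl y ∈ B → x ≠ y :=
    fun hx hy he => hx (he ▸ hy)
  refine ⟨B, ?_⟩
  refine
    { finite := hfin
      isClosed := ?_, nonempty := ?_, subset_of_diff := ?_, exists_mem := ?_, eq_of_mem := ?_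
      not_isPreconnected_pair := ?_, not_isPreconnected_triple := ?_, isPreconnected := ?_ }
  · rintro (k | i)
    · exact R.isClosedEmbedding_incl.isClosedMap _ (isClosed_closedEdge _)
    · exact S.isClosedEmbedding_incl.isClosedMap _ (isClosed_loop _)
  · rintro (k | i)
    · exact ⟨_, _, thetaVertex_mem false k, rfl⟩
    · exact ⟨_, _, loopBase_mem_loop i, rfl⟩
  · rintro (k | i) B' hB' Z hZ hsub
    · refine image_subset_iff.2 (closedEdge_subset_of_diff_finite _
        (hB'.preimage R.incl_injective.injOn) (hZ.preimage R.continuous_incl) ?_)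
      exact fun x hx => hsub ⟨⟨x, hx.1, rfl⟩, hx.2⟩
    · refine image_subset_iff.2 (iUnion_subset fun b => closedEdge_subset_of_diff_finite _
        (hB'.preimage S.incl_injective.injOn) (hZ.preimage S.continuous_incl) ?_)
      exact fun x hx => hsub ⟨⟨x, mem_iUnion.2 ⟨b, hx.1⟩, rfl⟩, hx.2⟩
  · intro x hx hpre
    have hrange : x ∈ range S.incl := by
      by_contra hr
      exact hcut x hr (fun hx0 => hx (Or.inr hx0)) hpre
    obtain ⟨y, rfl⟩ := hrange
    rcases mem_range_or_mem_loop y with ⟨z, rfl⟩ | ⟨i, hi⟩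
    · obtain ⟨k, hk⟩ := exists_mem_thetaArc (h.toHomeo z)
      refine ⟨Sum.inl k, _, hk, ?_⟩
      rw [thetaRetraction_incl, Homeomorph.symm_apply_apply]
    · exact ⟨Sum.inr i, y, hi, rfl⟩
  · have hmix : ∀ x ∉ B, ∀ k i, x ∈ thetaPart h S (Sum.inl k) →
        x ∉ thetaPart h S (Sum.inr i) := by
      rintro _ hx k i ⟨y, hy, rfl⟩ h2
      have := retr_of_mem_thetaPart h S h2
      rw [Retraction.retr_incl] at this
      exact hx (this ▸ hqB i)
    rintro x hx (k | i) (k' | i') h1 h2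
    · obtain ⟨y, hy, rfl⟩ := h1
      obtain ⟨z, hz, hyz⟩ := h2
      obtain rfl := R.incl_injective hyz
      rw [eq_of_mem_thetaArc hy hz (hvert hx)]
    · exact (hmix x hx k i' h1 h2).elim
    · exact (hmix x hx k' i h2 h1).elim
    · have := (retr_of_mem_thetaPart h S h1).symm.trans (retr_of_mem_thetaPart h S h2)
      rw [hinj this]
  · rintro x hx y hy hxy (k | i) h1 h2
    · obtain ⟨x, hx1, rfl⟩ := h1
      obtain ⟨y, hy1, rfl⟩ := h2
      rw [← image_pair, ← hR, R.isPreconnected_compl_image_iff (by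
        rw [disjoint_left]
        rintro _ (rfl | rfl)
        · exact hbase hx
        · exact hbase hy)]
      exact not_isPreconnected_of_mem_thetaArc hx1 hy1 (fun he => hxy (by rw [he]))
        (hvert hx) (hvert hy)
    · obtain ⟨x, hx1, rfl⟩ := h1
      obtain ⟨y, hy1, rfl⟩ := h2
      rw [← image_pair, S.isPreconnected_compl_image_iff (by
        rw [disjoint_left]
        rintro _ (rfl | rfl) hb
        · exact hB2 hx (Or.inl hb)
        · exact hB2 hy (Or.inl hb))]
      exact not_isPreconnected_of_mem_loop hx1 hy1 (fun he => hxy (by rw [he]))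
        (hne hx (hloopB i)) (hne hx (hvertB i)) (hne hy (hloopB i)) (hne hy (hvertB i))
  · intro x hx hmem
    choose y hy hyx using hmem
    obtain rfl : (fun k => R.incl (y k)) = x := funext hyx
    have : range (fun k => R.incl (y k)) = R.incl '' range y := range_comp R.incl y
    rw [this, R.isPreconnected_compl_image_iff (by
      rw [disjoint_left]
      rintro _ ⟨k, rfl⟩
      exact hbase (hx k))]
    exact not_isPreconnected_of_forall_mem_thetaArc hy fun k => hvert (hx k)
  · intro F hFB hFP hsub hmiss
    rw [disjoint_left] at hFB
    have hFS : S.incl '' (S.incl ⁻¹' F) = F := by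
      rw [image_preimage_eq_iff]
      intro x hx
      obtain ⟨k | i, hx⟩ := mem_iUnion.1 (hFP hx)
      · obtain ⟨y, -, rfl⟩ := hx
        exact ⟨_, (thetaRetraction_incl h S y).symm⟩
      · obtain ⟨y, -, rfl⟩ := hx
        exact ⟨y, rfl⟩
    rw [← hFS, S.isPreconnected_compl_image_iff (by
      rw [disjoint_left]
      exact fun x hx hb => hB2 (hFB hx) (Or.inl hb))]
    refine isPreconnected_compl_attachLoops ?_ (fun i hi => hFB hi (hloopB i))
      (fun i hi => hFB hi (hvertB i)) ?_
    · rintro i x ⟨hx, hx'⟩ y ⟨hy, hy'⟩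
      exact S.incl_injective (hsub (Sum.inr i) ⟨hx, x, hx', rfl⟩ ⟨hy, y, hy', rfl⟩)
    · have hpre : IsPreconnected (R.incl ⁻¹' F)ᶜ := by
        refine isPreconnected_compl_theta ?_ ?_
        · rintro k x ⟨hx, hx'⟩ y ⟨hy, hy'⟩
          exact R.incl_injective (hsub (Sum.inl k) ⟨hx, x, hx', rfl⟩ ⟨hy, y, hy', rfl⟩)
        · obtain ⟨k, hk⟩ := hmiss
          refine ⟨k, eq_empty_of_forall_notMem ?_⟩
          rintro x ⟨hx, hx'⟩
          exact (Set.ext_iff.1 hk (R.incl x)).1 ⟨hx, x, hx', rfl⟩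
      have := hpre.image _ h.toHomeo.symm.continuous.continuousOn
      convert this using 1
      ext x
      simp only [mem_compl_iff, mem_preimage, mem_image, hR, thetaRetraction_incl]
      constructor
      · exact fun hx => ⟨h.toHomeo x, by simpa using hx, by simp⟩
      · rintro ⟨y, hy, rfl⟩
        exact hy

end Looped

/-- If the fibers of a map to a graph of genus one are the orbits of an involution, there are no
parts `a ≠ b` with different orbits `{a, a'}` and `{b, b'}` that together avoid one of the arcs and
are such that a part fixed by the involution is fixed pointwise: removing the orbit of a generic
point of `a` and that of a generic point of `b` would not disconnect, and neither would removing
their two images. -/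
theorem false_of_independent_parts {X E : WeightedGraph} {I : Type*}
    {P : Fin 3 ⊕ I → Set X.Point} {B : Set X.Point} (hP : IsLoopedTheta P B) (hE : E.genus = 1)
    {φ : X.Point → E.Point} (hφ : Continuous φ) (hsurj : Function.Surjective φ)
    (ι : X.Point ≃ₜ X.Point) (hfib : ∀ x y, φ y = φ x ↔ y = x ∨ y = ι x) {a a' b b' : Fin 3 ⊕ I}
    (ha : MapsTo ι (P a) (P a')) (hb : MapsTo ι (P b) (P b'))
    (haa : a = a' → ∀ x ∈ P a, ι x = x) (hbb : b = b' → ∀ x ∈ P b, ι x = x)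
    (hab : a ≠ b) (hab' : a ≠ b') (ha'b : a' ≠ b) (ha'b' : a' ≠ b')
    (hk : ∃ k, a ≠ Sum.inl k ∧ a' ≠ Sum.inl k ∧ b ≠ Sum.inl k ∧ b' ≠ Sum.inl k) : False := by
  have := E.finV
  have hfin : (B ∪ ι ⁻¹' B ∪ φ ⁻¹' range Point.vertex).Finite := by
    refine (hP.finite.union (hP.finite.preimage ι.injective.injOn)).union
      ((finite_range _).preimage' fun y _ => ?_)
    obtain ⟨x, rfl⟩ := hsurj y
    exact (toFinite {x, ι x}).subset fun z hz => (hfib x z).1 hz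
  obtain ⟨x, hx, hxB⟩ := hP.exists_generic a hfin
  obtain ⟨y, hy, hyB⟩ := hP.exists_generic b hfin
  simp only [mem_union, mem_preimage, mem_range, not_or, not_exists] at hxB hyB
  have hφxy : φ x ≠ φ y := by
    intro he
    rcases (hfib x y).1 he.symm with rfl | rfl
    · exact hab (hP.eq_of_mem _ hyB.1.1 _ _ hx hy)
    · exact ha'b (hP.eq_of_mem _ hyB.1.1 _ _ (ha hx) hy)
  refine not_isPreconnected_compl_pair_of_genus_eq_one hE hφxy
    (fun v hv => hxB.2 v hv.symm) (fun v hv => hyB.2 v hv.symm) ?_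
  have hpre : IsPreconnected (range ![x, ι x, y, ι y])ᶜ := by
    refine hP.isPreconnected_range (p := ![a, a', b, b']) ?_ ?_ ?_ ?_
    · simp only [Fin.forall_fin_succ, IsEmpty.forall_iff, and_true]
      exact ⟨hxB.1.1, hxB.1.2, hyB.1.1, hyB.1.2⟩
    · simp only [Fin.forall_fin_succ, IsEmpty.forall_iff, and_true]
      exact ⟨hx, ha hx, hy, hb hy⟩
    · simp only [Fin.forall_fin_succ, IsEmpty.forall_iff, and_true]
      refine ⟨⟨?_, ?_, ?_, ?_⟩, ⟨?_, ?_, ?_, ?_⟩, ⟨?_, ?_, ?_, ?_⟩, ?_, ?_, ?_, ?_⟩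
      · exact fun _ => trivial
      · exact fun he => (haa he x hx).symm
      · exact fun he => (hab he).elim
      · exact fun he => (hab' he).elim
      · exact fun he => haa he.symm x hx
      · exact fun _ => trivial
      · exact fun he => (ha'b he).elim
      · exact fun he => (ha'b' he).elim
      · exact fun he => (hab he.symm).elim
      · exact fun he => (ha'b he.symm).elim
      · exact fun _ => trivial
      · exact fun he => (hbb he y hy).symm
      · exact fun he => (hab' he.symm).elim
      · exact fun he => (ha'b' he.symm).elim
      · exact fun he => hbb he.symm y hy
      · exact fun _ => trivial
    · obtain ⟨k, h1, h2, h3, h4⟩ := hk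
      refine ⟨k, ?_⟩
      simp only [Fin.forall_fin_succ, IsEmpty.forall_iff, and_true]
      exact ⟨h1, h2, h3, h4⟩
  have himg : φ '' (range ![x, ι x, y, ι y])ᶜ = {φ x, φ y}ᶜ := by
    have hr : range ![x, ι x, y, ι y] = φ ⁻¹' {φ x, φ y} := by
      ext z
      simp only [Matrix.range_cons, Matrix.range_empty, union_empty, mem_union, mem_singleton_iff,
        mem_preimage, mem_insert_iff, hfib, or_assoc]
    rw [hr, ← preimage_compl, image_preimage_eq _ hsurj]
  exact himg ▸ hpre.image _ hφ.continuousOn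

end WeightedGraph
end

open WeightedGraph in
theorem mainTheorem1 (n : ℕ) (hn : 2 ≤ n)
    (L : Fin 3 → ℝ≥0) (hL : ∀ i, 0 < L i) (hL' : Function.Injective L)
    (q : Fin (n + 1) → (theta L hL).Point) (hq : Function.Injective q)
    (hq0 : q 0 = thetaPoint L hL 0 (L 0 / 2))
    (hq1 : ∃ t, 0 < t ∧ t < L 1 / 2 ∧ q 1 = thetaPoint L hL 1 t)
    (hq2 : ∃ t, L 2 / 2 < t ∧ t < L 2 ∧ q 2 = thetaPoint L hL 2 t)
    (c : Fin (n + 1) → ℝ≥0) (hc : ∀ i, 0 < c i)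
    (G : WeightedGraph) (hG : IsObtainedByAttachingLoops (theta L hL) q c G) :
    ¬ ∃ G' : WeightedGraph, IsTropicalModification G G' ∧
      ∃ E : WeightedGraph, E.genus = 1 ∧
        ∃ φ : G'.Point → E.Point, IsFiniteHarmonicMorphism φ 2 := by
  rintro ⟨X, hX, E, hE, φ, hφ⟩
  obtain ⟨H, h, p, hp, hc', hpq, ⟨j⟩⟩ := hG
  obtain ⟨T, hT⟩ := hX.exists_retraction
  obtain ⟨hφc, hφs, ι, hfib, hι⟩ := hφ.exists_involution
  have hS := j.symm.attachesTrees.trans hT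
  generalize j.symm.retraction.trans T = S at hS
  have hpq' : (fun i => h.toHomeo (.vertex (p i))) = q := funext hpq
  obtain ⟨B, hP⟩ := exists_isLoopedTheta h S hS (hpq' ▸ hq)
  obtain ⟨τ, ρ, hτ, hρ⟩ := hP.exists_map_parts ι.toHomeo
  set R := thetaRetraction h S with hR
  have hrange : ∀ x, R.incl (R.retr (ι.toHomeo (R.incl x))) = ι.toHomeo (R.incl x) := by
    intro x
    obtain ⟨k, hk⟩ := exists_mem_thetaArc x
    obtain ⟨y, -, hy⟩ := hτ k ⟨x, hk, rfl⟩
    rw [← hR] at hy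
    rw [← hy, R.retr_incl]
  -- The involution of the theta graph that is induced by the involution of the whole graph.
  have hinv := theta_involution hL' (f := fun x => R.retr (ι.toHomeo (R.incl x)))
    (R.continuous_retr.comp (ι.toHomeo.continuous.comp R.continuous_incl))
    (fun x => by simp only [hrange, hι, R.retr_incl])
    (fun x y => by rw [← R.pathDist_incl, hrange, hrange, ι.pathDist_eq, R.pathDist_incl])
    (τ := τ) (fun k x hx => by
      obtain ⟨y, hy, hyx⟩ := hτ k ⟨x, hx, rfl⟩
      rw [← hR] at hyx
      simp only [← hyx, R.retr_incl]
      exact hy)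
  rcases hinv with hid | hflip
  · -- The points of the theta graph are fixed, so its edges are independent.
    have hfix : ∀ k, ∀ x ∈ thetaPart h S (Sum.inl k), ι.toHomeo x = x := by
      rintro k _ ⟨y, -, rfl⟩
      rw [← hR, ← hrange]
      exact congrArg R.incl (hid y)
    have hfix' : ∀ k, Set.MapsTo ι.toHomeo (thetaPart h S (Sum.inl k))
        (thetaPart h S (Sum.inl k)) := fun k x hx => (hfix k x hx).symm ▸ hx
    exact false_of_independent_parts hP hE hφc hφs ι.toHomeo hfib (hfix' 1) (hfix' 2)
      (fun _ => hfix 1) (fun _ => hfix 2) (by simp) (by simp) (by simp) (by simp) ⟨0, by simp⟩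
  · -- The loops at `q 1` and `q 2` are moved to different loops.
    have hbase : ∀ i, q (ρ i) = R.retr (ι.toHomeo (R.incl (q i))) := by
      intro i
      rw [← hpq i, ← hpq (ρ i)]
      exact (retr_of_mem_thetaPart h S (hρ i (incl_mem_thetaPart h S i))).symm
    have hpath : ∀ k (t : ℝ≥0), thetaPoint L hL k t = thetaPath L hL k t := by
      intro k t
      unfold thetaPath
      rw [ENNReal.ofReal_coe_nnreal]
      rfl
    have key : ∀ i k, ∀ t : ℝ≥0, 0 < t → t < L k → t ≠ L k / 2 → q i = thetaPoint L hL k t →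
        i ≠ ρ i ∧ (∀ k', q i ∈ thetaArc L hL k' → k = k') ∧
          ∀ k', q (ρ i) ∈ thetaArc L hL k' → k = k' := by
      intro i k t h0 h1 h2 hqi
      rw [hpath] at hqi
      have ht : (t : ℝ) ∈ Set.Ioo (0 : ℝ) (L k) := ⟨by exact_mod_cast h0, by exact_mod_cast h1⟩
      have ht' : (L k - t : ℝ) ∈ Set.Ioo (0 : ℝ) (L k) := ⟨by linarith [ht.2], by linarith [ht.1]⟩
      have hqi' : q (ρ i) = thetaPath L hL k (L k - t) := by
        rw [hbase, hqi]
        exact hflip k t (Set.Ioo_subset_Icc_self ht)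
      refine ⟨fun he => h2 ?_, fun k' hk' => ?_, fun k' hk' => ?_⟩
      · rw [← he, hqi] at hqi'
        have := thetaPath_inj (Set.Ioo_subset_Icc_self ht) (Set.Ioo_subset_Icc_self ht') hqi'
        rw [← NNReal.coe_inj, NNReal.coe_div, NNReal.coe_ofNat]
        linarith
      · rw [hqi] at hk'
        exact eq_of_mem_thetaArc (thetaPath_mem k ht.2.le) hk' (thetaPath_ne_thetaVertex ht)
      · rw [hqi'] at hk'
        exact eq_of_mem_thetaArc (thetaPath_mem k ht'.2.le) hk' (thetaPath_ne_thetaVertex ht')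
    have hmem : ∀ i, ∃ k, q i ∈ thetaArc L hL k := fun i => exists_mem_thetaArc (q i)
    obtain ⟨s, hs0, hs1, hqs⟩ := hq1
    obtain ⟨t, ht0, ht1, hqt⟩ := hq2
    obtain ⟨h1, h2, h3⟩ := key 1 1 s hs0 (hs1.trans (half_lt_self (hL 1))) hs1.ne hqs
    obtain ⟨h4, h5, h6⟩ := key 2 2 t ((half_pos (hL 2)).trans ht0) ht1 ht0.ne' hqt
    have hcontra : ∀ i, (∀ k, q i ∈ thetaArc L hL k → 1 = k) →
        (∀ k, q i ∈ thetaArc L hL k → 2 = k) → False := by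
      intro i hi hi'
      obtain ⟨k, hk⟩ := hmem i
      exact absurd ((hi k hk).trans (hi' k hk).symm) (by decide)
    refine false_of_independent_parts hP hE hφc hφs ι.toHomeo hfib (hρ 1) (hρ 2)
      (fun he => (h1 (Sum.inr_injective he)).elim) (fun he => (h4 (Sum.inr_injective he)).elim)
      (fun he => ?_) (fun he => ?_) (fun he => ?_) (fun he => ?_)
      ⟨0, Sum.inr_ne_inl, Sum.inr_ne_inl, Sum.inr_ne_inl, Sum.inr_ne_inl⟩
    · exact hcontra 1 h2 (Sum.inr_injective he ▸ h5)
    · exact hcontra 1 h2 (Sum.inr_injective he ▸ h6)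
    · exact hcontra (ρ 1) h3 (Sum.inr_injective he ▸ h5)
    · exact hcontra (ρ 1) h3 (Sum.inr_injective he ▸ h6)
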